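/- Let $\zeta$ be the Riemann zeta function, $\gamma$ the Euler--Mascheroni constant, and let $\gamma(j)$, $j\ge 0$, be the Stieltjes constants, i.e. $\zeta(s)=\frac{1}{s-1}+\sum_{j\ge 0}\frac{(-1)^j}{j!}\gamma(j)(s-1)^j$ for $s\neq 1$. (A) Let $a,b$ be real numbers with $0<a<1$, $a+b>1$ (hence $b>0$) and $a\neq 1-\frac b2$, and write $A=\pi(a-1)/b$ (then $\cos A\ne 0$). The following three integrals converge absolutely, and $$\int_{-\infty}^{\infty}\frac{\zeta(a+iv)\,\zeta(a+b-iv)}{\cosh(\pi v/b)}\,dv = b\,\zeta\!\left(a+\tfrac b2\right)^2-\frac{2\pi\,\zeta(2a-1+b)}{\cos A},$$ $$\int_{-\infty}^{\infty}\frac{\bigl(\zeta(a+iv)+\zeta(a+b-iv)\bigr)^2}{\cosh(\pi v/b)}\,dv = 4b\,\zeta\!\left(a+\tfrac b2\right)^2-\frac{4\gamma\pi}{\cos A}+\frac{2\pi^2}{b}\,\frac{\sin A}{\cos^2 A}-\frac{4\pi\,\zeta(2a-1+b)}{\cos A},$$ $$\int_{-\infty}^{\infty}\frac{\bigl(\zeta(a+iv)-\zeta(a+b-iv)\bigr)^2}{\cosh(\pi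 v/b)}\,dv = -\frac{4\gamma\pi}{\cos A}+\frac{2\pi^2}{b}\,\frac{\sin A}{\cos^2 A}+\frac{4\pi\,\zeta(2a-1+b)}{\cos A}.$$ (B) Let $0<b<2$. As $a\to 1-\frac b2$ with $a\neq 1-\frac b2$, the right-hand side of the third formula tends to $-8b\,\gamma(1)+\frac{2\pi^2}{3b}$. The integral at $a=1-\frac b2$ converges absolutely and has this value: $$\int_{-\infty}^{\infty}\frac{\bigl(\zeta(1-\frac b2+iv)-\zeta(1+\frac b2-iv)\bigr)^2}{\cosh(\pi v/b)}\,dv=-8b\,\gamma(1)+\frac{2\pi^2}{3b}.$$ -/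

import Mathlib

open MeasureTheory Filter Topology

/-- The Stieltjes constants `γ(j)`, defined by the Laurent expansion of the Riemann zeta function
at `1`: `ζ(s) = 1 / (s - 1) + ∑ j, (-1) ^ j / j! * γ(j) * (s - 1) ^ j`. Here `riemannZeta₀` is the
entire function that equals `ζ(s) - 1 / (s - 1)` for `s ≠ 1`. -/
noncomputable def stieltjesGamma (j : ℕ) : ℂ :=
  (-1) ^ j * iteratedDeriv j riemannZeta₀ 1

/-- The Laurent expansion that characterizes the Stieltjes constants. -/
theorem hasSum_stieltjesGamma {s : ℂ} (hs : s ≠ 1) :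
    HasSum (fun j : ℕ => (-1) ^ j / (j.factorial : ℂ) * stieltjesGamma j * (s - 1) ^ j)
      (riemannZeta s - 1 / (s - 1)) := by
  have h := Complex.hasSum_taylorSeries_of_entire differentiable_riemannZeta₀ 1 s
  have h0 : riemannZeta₀ s = riemannZeta s - 1 / (s - 1) := by
    rw [riemannZeta_eq_inv_sub_add hs]
    simp
  rw [h0] at h
  have e : (fun j : ℕ => (-1) ^ j / (j.factorial : ℂ) * stieltjesGamma j * (s - 1) ^ j) =
      fun j : ℕ => (j.factorial : ℂ)⁻¹ • (s - 1) ^ j • iteratedDeriv j riemannZeta₀ 1 := by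
    funext j
    have h1 : ((-1 : ℂ) ^ j) * (-1) ^ j = 1 := by rw [← mul_pow]; simp
    simp only [stieltjesGamma, smul_eq_mul]
    linear_combination (iteratedDeriv j riemannZeta₀ 1 * (s - 1) ^ j / (j.factorial : ℂ)) * h1
  rw [e]
  exact h

/-! Integrate `F(s) = f(s) / cos(π(s - a)/b)` along the edges of the strip `a ≤ re s ≤ a + b`. The
strip is half a period of the cosine wide, so the kernel equals `1/cosh(πv/b)` on the left edge and
`-1/cosh(πv/b)` on the right one. Right minus left is therefore minus a sum of two integrals of the
required type, and the residue theorem (`integral_strip_sub_eq`) evaluates it.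

For `f(s) = ζ(s) ζ(2a + b - s)` the reflection `s ↦ 2a + b - s` swaps the edges, so both give the
same integral. The poles are `1`, its mirror image `2a + b - 1`, and the midpoint `a + b/2`, where
the cosine vanishes. For `f = ζ²` the edges give the two integrals of squares, and the double pole
at `1` produces `γ` and the `sin/cos²` term. Expanding `(ζ ± ζ)²` yields (A).

The contour argument needs only linear growth of `ζ` for `re s ≥ a > 0`, which the kernel's
exponential decay beats. At `a = 1 - b/2` the poles collide but the integrand stays regular, so (B)
follows from continuity of the integral in `a` and a limit of the closed formula
(`tendsto_residue_formula`). -/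

/-! ### Linear growth of `ζ(s) - 1/(s - 1)` on `re s > 0` -/

/-- The Mellin integrand whose transform gives the continuation of `ζ` to `0 < re s`: the
fractional part, cut off to `(1, ∞)`. -/
noncomputable def fractIndicator : ℝ → ℂ :=
  (Set.Ioi (1 : ℝ)).indicator fun t => ((Int.fract t : ℝ) : ℂ)

lemma norm_fractIndicator_le (t : ℝ) : ‖fractIndicator t‖ ≤ 1 := by
  unfold fractIndicator
  refine (norm_indicator_le_norm_self _ _).trans ?_
  rw [Complex.norm_real, Real.norm_of_nonneg (Int.fract_nonneg t)]
  exact (Int.fract_lt_one t).le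

lemma measurable_fractIndicator : Measurable fractIndicator :=
  (Complex.measurable_ofReal.comp measurable_fract).indicator measurableSet_Ioi

lemma mellin_fractIndicator (z : ℂ) :
    mellin fractIndicator z =
      ∫ t in Set.Ioi (1 : ℝ), (t : ℂ) ^ (z - 1) * ((Int.fract t : ℝ) : ℂ) := by
  have h : (fun t : ℝ => (t : ℂ) ^ (z - 1) • fractIndicator t) =
      (Set.Ioi (1 : ℝ)).indicator
        fun t => (t : ℂ) ^ (z - 1) * ((Int.fract t : ℝ) : ℂ) := by
    funext t
    by_cases ht : t ∈ Set.Ioi (1 : ℝ) <;> simp [fractIndicator, ht]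
  rw [mellin, h, setIntegral_indicator measurableSet_Ioi]
  congr 2
  ext t
  simp only [Set.mem_inter_iff, Set.mem_Ioi]
  exact ⟨fun h => h.2, fun h => ⟨by linarith, h⟩⟩

lemma differentiableAt_mellin_fractIndicator {z : ℂ} (hz : z.re < 0) :
    DifferentiableAt ℂ (mellin fractIndicator) z := by
  -- The function is bounded at infinity and vanishes near `0`, so any exponent below `z.re` serves
  -- at `0`.
  refine mellin_differentiableAt_of_isBigO_rpow (a := 0) (b := z.re - 1) ?_ ?_ hz ?_ (by linarith)
  · refine LocallyIntegrable.locallyIntegrableOn ?_ _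
    refine (locallyIntegrable_const (1 : ℝ)).mono
      measurable_fractIndicator.aestronglyMeasurable ?_
    exact Eventually.of_forall fun t => by simpa using norm_fractIndicator_le t
  · refine Asymptotics.IsBigO.of_bound 1 (Eventually.of_forall fun t => ?_)
    simpa using norm_fractIndicator_le t
  · refine Asymptotics.IsBigO.of_bound 1 ?_
    have h1 : ∀ᶠ t : ℝ in 𝓝[>] 0, t < 1 := nhdsWithin_le_nhds (gt_mem_nhds one_pos)
    filter_upwards [h1] with t ht
    have : fractIndicator t = 0 := by simp [fractIndicator, ht.le]
    rw [this, norm_zero]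
    positivity

lemma norm_mellin_fractIndicator_le {z : ℂ} (hz : z.re < 0) :
    ‖mellin fractIndicator z‖ ≤ 1 / -z.re := by
  rw [mellin_fractIndicator]
  have hi : ∫ t in Set.Ioi (1 : ℝ), t ^ (z.re - 1) = 1 / -z.re := by
    rw [integral_Ioi_rpow_of_lt (by linarith) one_pos]
    simp
    rw [div_eq_mul_inv]; simp
  rw [← hi]
  refine norm_integral_le_of_norm_le (integrableOn_Ioi_rpow_of_lt (by linarith) one_pos) ?_
  filter_upwards [ae_restrict_mem measurableSet_Ioi] with t ht
  have ht : (1 : ℝ) < t := ht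
  rw [norm_mul, Complex.norm_cpow_eq_rpow_re_of_pos (by linarith), Complex.norm_real,
    Real.norm_of_nonneg (Int.fract_nonneg t)]
  simp only [Complex.sub_re, Complex.one_re]
  exact mul_le_of_le_one_right (by positivity) (Int.fract_lt_one t).le

/-- Abel summation gives `ζ(s) = s ∫ ⌊t⌋ t^(-s-1)` over `t > 1`. In `⌊t⌋ = t - {t}` the term `t`
contributes `s/(s - 1) = 1 + 1/(s - 1)`, which cancels the pole. -/
lemma riemannZeta₀_eq_of_one_lt_re {s : ℂ} (hs : 1 < s.re) :
    riemannZeta₀ s = 1 - s * mellin fractIndicator (-s) := by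
  have hs1 : s ≠ 1 := by rintro rfl; simp at hs
  have hs0 : s - 1 ≠ 0 := sub_ne_zero.2 hs1
  have hz : riemannZeta s = s * ∫ t in Set.Ioi (1 : ℝ), (⌊t⌋₊ : ℂ) * (t : ℂ) ^ (-(s + 1)) := by
    rw [← LSeries_one_eq_riemannZeta hs,
      LSeries_eq_mul_integral' 1 zero_le_one hs]
    · simp
    · refine Asymptotics.IsBigO.of_bound 1 (Eventually.of_forall fun n => ?_)
      simp
  have hint : ∫ t in Set.Ioi (1 : ℝ), (⌊t⌋₊ : ℂ) * (t : ℂ) ^ (-(s + 1)) =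
      (∫ t in Set.Ioi (1 : ℝ), (t : ℂ) ^ (-s)) - mellin fractIndicator (-s) := by
    rw [mellin_fractIndicator, ← integral_sub]
    · refine setIntegral_congr_fun measurableSet_Ioi fun t ht => ?_
      have ht : (1 : ℝ) < t := ht
      have ht0 : (t : ℂ) ≠ 0 := by exact_mod_cast (by linarith : t ≠ 0)
      have e : ((⌊t⌋₊ : ℝ) : ℂ) = t - ((Int.fract t : ℝ) : ℂ) := by
        rw [← Complex.ofReal_sub, natCast_floor_eq_intCast_floor (by linarith),
          Int.self_sub_fract]
      have e2 : (t : ℂ) ^ (-s) = t * (t : ℂ) ^ (-s - 1) := by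
        rw [Complex.cpow_sub _ _ ht0, Complex.cpow_one]; field_simp
      have e3 : -(s + 1) = -s - 1 := by ring
      simp only [Complex.ofReal_natCast] at e
      simp only [e, e2, e3]; ring
    · exact integrableOn_Ioi_cpow_of_lt (by simpa using hs) one_pos
    · refine Integrable.mono' (integrableOn_Ioi_rpow_of_lt (a := -s.re - 1) (by linarith) one_pos)
        ?_ ?_
      · refine AEStronglyMeasurable.mul ?_
          (Complex.measurable_ofReal.comp measurable_fract).aestronglyMeasurable
        exact (integrableOn_Ioi_cpow_of_lt (a := -s - 1) (by simp; linarith)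
          one_pos).aestronglyMeasurable
      · filter_upwards [ae_restrict_mem measurableSet_Ioi] with t ht
        have ht : (1 : ℝ) < t := ht
        rw [norm_mul, Complex.norm_cpow_eq_rpow_re_of_pos (by linarith), Complex.norm_real,
          Real.norm_of_nonneg (Int.fract_nonneg t)]
        simp only [Complex.sub_re, Complex.one_re, Complex.neg_re]
        exact mul_le_of_le_one_right (by positivity) (Int.fract_lt_one t).le
  rw [hint, integral_Ioi_cpow_of_lt (by simpa using hs) one_pos,
    riemannZeta_eq_inv_sub_add hs1] at hz
  have hs2 : -s + 1 ≠ 0 := by intro h; apply hs0; linear_combination -h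
  have e4 : -(1 : ℂ) / (-s + 1) = (s - 1)⁻¹ := by
    rw [← neg_div_neg_eq]; simp; ring
  simp only [Complex.ofReal_one, Complex.one_cpow, e4] at hz
  have e5 : s * (s - 1)⁻¹ = 1 + (s - 1)⁻¹ := by field_simp; ring
  linear_combination hz + e5

/-- Identity theorem on the connected half-plane, where both sides are analytic. -/
lemma riemannZeta₀_eq_of_re_pos {s : ℂ} (hs : 0 < s.re) :
    riemannZeta₀ s = 1 - s * mellin fractIndicator (-s) := by
  have ho : IsOpen {s : ℂ | 0 < s.re} := isOpen_lt continuous_const Complex.continuous_re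
  have hf : AnalyticOnNhd ℂ riemannZeta₀ {s : ℂ | 0 < s.re} :=
    fun z _ => differentiable_riemannZeta₀.analyticAt z
  have hg : AnalyticOnNhd ℂ (fun s => 1 - s * mellin fractIndicator (-s)) {s : ℂ | 0 < s.re} := by
    refine DifferentiableOn.analyticOnNhd (fun z hz => ?_) ho
    have hz' : (-z).re < 0 := by simpa using hz
    have h1 : DifferentiableAt ℂ (fun s : ℂ => mellin fractIndicator (-s)) z :=
      (differentiableAt_mellin_fractIndicator hz').comp z differentiableAt_id.neg
    exact ((differentiableAt_const 1).sub (differentiableAt_id.mul h1)).differentiableWithinAt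
  refine hf.eqOn_of_preconnected_of_eventuallyEq hg
    (convex_halfSpace_re_gt 0).isPreconnected (z₀ := 2) (by simp) ?_ hs
  have : {s : ℂ | 1 < s.re} ∈ 𝓝 (2 : ℂ) :=
    (isOpen_lt continuous_const Complex.continuous_re).mem_nhds (by simp)
  filter_upwards [this] with z hz using riemannZeta₀_eq_of_one_lt_re hz

lemma norm_riemannZeta₀_le {s : ℂ} (hs : 0 < s.re) : ‖riemannZeta₀ s‖ ≤ 1 + ‖s‖ / s.re := by
  rw [riemannZeta₀_eq_of_re_pos hs]
  refine (norm_sub_le _ _).trans ?_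
  rw [norm_one, norm_mul, div_eq_mul_one_div]
  have := norm_mellin_fractIndicator_le (z := -s) (by simpa using hs)
  simp only [Complex.neg_re, neg_neg] at this
  gcongr

/-! ### Residue theorem on a vertical strip -/

/-- The primitive is `arctan(v/x) - (i/2) log(x² + v²)`; its logarithmic part is even and cancels
between `±T`. -/
lemma intervalIntegral_inv_add_mul_I {x : ℝ} (hx : x ≠ 0) (T : ℝ) :
    ∫ v in (-T)..T, ((x : ℂ) + v * Complex.I)⁻¹ = ((2 * Real.arctan (T / x) : ℝ) : ℂ) := by
  have hpos : ∀ v : ℝ, 0 < x ^ 2 + v ^ 2 := fun v => by positivity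
  have hne : ∀ v : ℝ, (x : ℂ) + v * Complex.I ≠ 0 := fun v h => hx (by
    simpa using congrArg Complex.re h)
  have hd : ∀ v : ℝ, HasDerivAt (fun v : ℝ => ((Real.arctan (v / x) : ℝ) : ℂ)
      - ((Real.log (x ^ 2 + v ^ 2) / 2 : ℝ) : ℂ) * Complex.I) ((x : ℂ) + v * Complex.I)⁻¹ v := by
    intro v
    have h1 : HasDerivAt (fun v : ℝ => Real.arctan (v / x)) (x / (x ^ 2 + v ^ 2)) v := by
      refine HasDerivAt.congr_deriv ((hasDerivAt_id' v).div_const x).arctan ?_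
      have := hpos v
      field_simp
    have h2 : HasDerivAt (fun v : ℝ => Real.log (x ^ 2 + v ^ 2) / 2) (v / (x ^ 2 + v ^ 2)) v := by
      refine HasDerivAt.congr_deriv
        (((((hasDerivAt_id' v).pow 2).const_add (x ^ 2)).log (hpos v).ne').div_const 2) ?_
      have := hpos v
      simp
      field_simp
    refine HasDerivAt.congr_deriv (h1.ofReal_comp.sub (h2.ofReal_comp.mul_const Complex.I)) ?_
    have h4 : ((x : ℂ) ^ 2 + (v : ℂ) ^ 2) ≠ 0 := by exact_mod_cast (hpos v).ne'
    have h5 := hne v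
    push_cast
    field_simp
    linear_combination (-(v : ℂ) ^ 2) * Complex.I_sq
  rw [intervalIntegral.integral_eq_sub_of_hasDerivAt (fun v _ => hd v)]
  · simp only [neg_div, Real.arctan_neg, neg_sq]
    push_cast; ring
  · refine Continuous.intervalIntegrable ?_ _ _
    exact Continuous.inv₀ (by fun_prop) hne

lemma intervalIntegral_inv_sq_add_mul_I {x : ℝ} (hx : x ≠ 0) (T : ℝ) :
    ∫ v in (-T)..T, (((x : ℂ) + v * Complex.I) ^ 2)⁻¹ =
      Complex.I * ((x : ℂ) + T * Complex.I)⁻¹ - Complex.I * ((x : ℂ) - T * Complex.I)⁻¹ := by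
  have hne : ∀ v : ℝ, (x : ℂ) + v * Complex.I ≠ 0 := fun v h => hx (by
    simpa using congrArg Complex.re h)
  have hd : ∀ v : ℝ, HasDerivAt (fun v : ℝ => Complex.I * ((x : ℂ) + v * Complex.I)⁻¹)
      (((x : ℂ) + v * Complex.I) ^ 2)⁻¹ v := by
    intro v
    have h1 : HasDerivAt (fun v : ℝ => (x : ℂ) + v * Complex.I) Complex.I v := by
      simpa using ((Complex.ofRealCLM.hasDerivAt (x := v)).mul_const Complex.I).const_add (x : ℂ)
    refine HasDerivAt.congr_deriv ((h1.inv (hne v)).const_mul Complex.I) ?_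
    rw [mul_div_assoc', mul_neg, Complex.I_mul_I, neg_neg, one_div]
  rw [intervalIntegral.integral_eq_sub_of_hasDerivAt (fun v _ => hd v)]
  · push_cast
    simp [sub_eq_add_neg]
  · refine Continuous.intervalIntegrable ?_ _ _
    exact Continuous.inv₀ (by fun_prop) fun v => pow_ne_zero 2 (hne v)

/-- Symmetric integral over the right edge minus the left edge of the strip `α ≤ re s ≤ β`,
truncated at height `T`. -/
noncomputable def stripBoundaryIntegral (α β : ℝ) (F : ℂ → ℂ) (T : ℝ) : ℂ :=
  (∫ v in (-T)..T, F (β + v * Complex.I)) - ∫ v in (-T)..T, F (α + v * Complex.I)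

/-- `F` tends to zero at both ends of the strip `α ≤ re s ≤ β`, uniformly in `re s`. -/
def StripDecay (α β : ℝ) (F : ℂ → ℂ) : Prop :=
  ∃ φ : ℝ → ℝ, Tendsto φ atTop (𝓝 0) ∧ ∀ᶠ T in atTop, ∀ x ∈ Set.Icc α β, ∀ y : ℝ, |y| = T →
    ‖F (x + y * Complex.I)‖ ≤ φ T

lemma StripDecay.sub {α β : ℝ} {F G : ℂ → ℂ} (hF : StripDecay α β F) (hG : StripDecay α β G) :
    StripDecay α β (fun s => F s - G s) := by
  obtain ⟨φ, h1, h2⟩ := hF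
  obtain ⟨ψ, h3, h4⟩ := hG
  refine ⟨fun T => φ T + ψ T, by simpa using h1.add h3, ?_⟩
  filter_upwards [h2, h4] with T ha hb x hx y hy
  exact (norm_sub_le _ _).trans (add_le_add (ha x hx y hy) (hb x hx y hy))

lemma StripDecay.add {α β : ℝ} {F G : ℂ → ℂ} (hF : StripDecay α β F) (hG : StripDecay α β G) :
    StripDecay α β (fun s => F s + G s) := by
  obtain ⟨φ, h1, h2⟩ := hF
  obtain ⟨ψ, h3, h4⟩ := hG
  refine ⟨fun T => φ T + ψ T, by simpa using h1.add h3, ?_⟩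
  filter_upwards [h2, h4] with T ha hb x hx y hy
  exact (norm_add_le _ _).trans (add_le_add (ha x hx y hy) (hb x hx y hy))

lemma stripDecay_div_pow (α β p : ℝ) (q : ℂ) {n : ℕ} (hn : n ≠ 0) :
    StripDecay α β (fun s => q / (s - p) ^ n) := by
  refine ⟨fun T => ‖q‖ / T ^ n, tendsto_const_nhds.div_atTop (tendsto_pow_atTop hn), ?_⟩
  filter_upwards [eventually_gt_atTop 0] with T hT x _ y hy
  rw [norm_div, norm_pow]
  have : T ≤ ‖(x : ℂ) + y * Complex.I - p‖ := by
    rw [← hy]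
    simpa using Complex.abs_im_le_norm ((x : ℂ) + y * Complex.I - p)
  gcongr

lemma StripDecay.congr {α β : ℝ} {F G : ℂ → ℂ} (hF : StripDecay α β F)
    (h : ∀ s : ℂ, s.im ≠ 0 → G s = F s) : StripDecay α β G := by
  obtain ⟨φ, h1, h2⟩ := hF
  refine ⟨φ, h1, ?_⟩
  filter_upwards [h2, eventually_gt_atTop 0] with T ha hT x hx y hy
  rw [h]
  · exact ha x hx y hy
  · have : y ≠ 0 := by rintro rfl; simp at hy; linarith
    simpa using this

/-- Cauchy on the rectangle of height `±T`: each horizontal side contributes at most `(β - α) φ(T)`.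
-/
lemma tendsto_stripBoundaryIntegral_of_differentiableAt {α β : ℝ} (hαβ : α ≤ β) {F : ℂ → ℂ}
    (hd : ∀ s : ℂ, α ≤ s.re → s.re ≤ β → DifferentiableAt ℂ F s) (hF : StripDecay α β F) :
    Tendsto (stripBoundaryIntegral α β F) atTop (𝓝 0) := by
  obtain ⟨φ, h1, h2⟩ := hF
  have hlim : Tendsto (fun T => 2 * (β - α) * φ T) atTop (𝓝 0) := by
    simpa using h1.const_mul (2 * (β - α))
  refine squeeze_zero_norm' ?_ hlim
  filter_upwards [h2, eventually_gt_atTop 0] with T hT hT0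
  have key := Complex.integral_boundary_rect_eq_zero_of_differentiableOn F
    (α + (-T : ℝ) * Complex.I) (β + T * Complex.I) (fun s hs => by
      have hs1 := hs.1
      simp [Set.uIcc_of_le hαβ] at hs1
      exact (hd s hs1.1 hs1.2).differentiableWithinAt)
  simp only [Complex.add_re, Complex.ofReal_re, Complex.mul_re, Complex.I_re, mul_zero,
    Complex.ofReal_im, Complex.I_im, mul_one, sub_self, add_zero, Complex.add_im,
    Complex.mul_im, zero_add, smul_eq_mul] at key
  have hb : ∀ y : ℝ, |y| = T → ‖∫ x : ℝ in α..β, F (x + y * Complex.I)‖ ≤ φ T * |β - α| := by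
    intro y hy
    refine intervalIntegral.norm_integral_le_of_norm_le_const fun x hx => ?_
    rw [Set.uIoc_of_le hαβ] at hx
    exact hT x ⟨hx.1.le, hx.2⟩ y hy
  have b1 := hb (-T) (by rw [abs_neg, abs_of_pos hT0])
  have b2 := hb T (abs_of_pos hT0)
  have e : stripBoundaryIntegral α β F T = Complex.I *
      ((∫ x : ℝ in α..β, F (x + (-T : ℝ) * Complex.I)) -
        ∫ x : ℝ in α..β, F (x + T * Complex.I)) := by
    unfold stripBoundaryIntegral
    linear_combination (-Complex.I) * key +
      ((∫ v in (-T)..T, F (β + v * Complex.I)) - ∫ v in (-T)..T, F (α + v * Complex.I)) *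
        Complex.I_sq
  rw [e, norm_mul, Complex.norm_I, one_mul]
  refine (norm_sub_le _ _).trans ((add_le_add b1 b2).trans (le_of_eq ?_))
  rw [abs_of_nonneg (sub_nonneg.2 hαβ)]; ring

lemma tendsto_intervalIntegral_inv_sq {x : ℝ} (hx : x ≠ 0) :
    Tendsto (fun T : ℝ => ∫ v in (-T)..T, (((x : ℂ) + v * Complex.I) ^ 2)⁻¹) atTop (𝓝 0) := by
  simp only [intervalIntegral_inv_sq_add_mul_I hx]
  have h : ∀ σ : ℝ, |σ| = 1 →
      Tendsto (fun T : ℝ => Complex.I * ((x : ℂ) + (σ * T : ℝ) * Complex.I)⁻¹) atTop (𝓝 0) := by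
    intro σ hσ
    refine squeeze_zero_norm' ?_ tendsto_inv_atTop_zero
    filter_upwards [eventually_gt_atTop 0] with T hT
    rw [norm_mul, Complex.norm_I, one_mul, norm_inv]
    refine inv_anti₀ hT ?_
    have := Complex.abs_im_le_norm ((x : ℂ) + (σ * T : ℝ) * Complex.I)
    simpa [abs_mul, hσ, abs_of_pos hT] using this
  have h1 := (h 1 (by simp)).sub (h (-1) (by simp))
  simpa [sub_eq_add_neg] using h1

/-- Since `1/(s - p)` is not absolutely integrable on the edges, the truncation is symmetric. The
arctangents tend to `π/2` and `-π/2` on the two sides of `p`; the double-pole term dies out. -/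
lemma tendsto_stripBoundaryIntegral_principalPart {α β p : ℝ} (hα : α < p) (hβ : p < β)
    (q r : ℂ) :
    Tendsto (stripBoundaryIntegral α β (fun s => q / (s - p) ^ 2 + r / (s - p))) atTop
      (𝓝 (2 * Real.pi * r)) := by
  have hb : β - p ≠ 0 := by linarith
  have ha : α - p ≠ 0 := by linarith
  have hsplit : ∀ x : ℝ, x - p ≠ 0 → ∀ T : ℝ,
      (∫ v in (-T)..T, (q / ((x : ℂ) + v * Complex.I - p) ^ 2
        + r / ((x : ℂ) + v * Complex.I - p))) =
      q * (∫ v in (-T)..T, ((((x - p : ℝ) : ℂ) + v * Complex.I) ^ 2)⁻¹) +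
      r * ((2 * Real.arctan (T / (x - p)) : ℝ) : ℂ) := by
    intro x hx T
    have hne : ∀ v : ℝ, ((x - p : ℝ) : ℂ) + v * Complex.I ≠ 0 := fun v h => hx (by
      simpa using congrArg Complex.re h)
    rw [← intervalIntegral_inv_add_mul_I hx, ← intervalIntegral.integral_const_mul,
      ← intervalIntegral.integral_const_mul, ← intervalIntegral.integral_add]
    · refine intervalIntegral.integral_congr fun v _ => ?_
      simp only [div_eq_mul_inv]
      have : (x : ℂ) + v * Complex.I - p = ((x - p : ℝ) : ℂ) + v * Complex.I := by
        push_cast; ring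
      rw [this]
    · refine Continuous.intervalIntegrable (continuous_const.mul ?_) _ _
      exact Continuous.inv₀ (by fun_prop) fun v => pow_ne_zero 2 (hne v)
    · refine Continuous.intervalIntegrable (continuous_const.mul ?_) _ _
      exact Continuous.inv₀ (by fun_prop) hne
  have e : stripBoundaryIntegral α β (fun s => q / (s - p) ^ 2 + r / (s - p)) = fun T =>
      (q * (∫ v in (-T)..T, ((((β - p : ℝ) : ℂ) + v * Complex.I) ^ 2)⁻¹) +
      r * ((2 * Real.arctan (T / (β - p)) : ℝ) : ℂ)) -
      (q * (∫ v in (-T)..T, ((((α - p : ℝ) : ℂ) + v * Complex.I) ^ 2)⁻¹) +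
      r * ((2 * Real.arctan (T / (α - p)) : ℝ) : ℂ)) := by
    funext T
    rw [stripBoundaryIntegral, hsplit β hb, hsplit α ha]
  rw [e]
  have t1 : Tendsto (fun T : ℝ => 2 * Real.arctan (T / (β - p))) atTop (𝓝 Real.pi) := by
    have : Tendsto (fun T : ℝ => T / (β - p)) atTop atTop :=
      tendsto_id.atTop_div_const (by linarith)
    have := ((tendsto_nhds_of_tendsto_nhdsWithin Real.tendsto_arctan_atTop).comp this).const_mul 2
    have e : 2 * (Real.pi / 2) = Real.pi := by ring
    rw [e] at this
    exact this
  have t2 : Tendsto (fun T : ℝ => 2 * Real.arctan (T / (α - p))) atTop (𝓝 (-Real.pi)) := by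
    have : Tendsto (fun T : ℝ => T / (α - p)) atTop atBot :=
      tendsto_id.atTop_div_const_of_neg (by linarith)
    have := ((tendsto_nhds_of_tendsto_nhdsWithin Real.tendsto_arctan_atBot).comp this).const_mul 2
    have e : 2 * -(Real.pi / 2) = -Real.pi := by ring
    rw [e] at this
    exact this
  have c1 := (Complex.continuous_ofReal.tendsto _).comp t1
  have c2 := (Complex.continuous_ofReal.tendsto _).comp t2
  have := (((tendsto_intervalIntegral_inv_sq hb).const_mul q).add (c1.const_mul r)).sub
    (((tendsto_intervalIntegral_inv_sq ha).const_mul q).add (c2.const_mul r))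
  have e2 : q * 0 + r * (Real.pi : ℂ) - (q * 0 + r * ((-Real.pi : ℝ) : ℂ)) = 2 * Real.pi * r := by
    push_cast; ring
  rw [e2] at this
  exact this

/-- Residue theorem for a strip: `F` has at most double poles with residue `r p` at the real
points `p ∈ P`, and decays at both ends of the strip. -/
theorem tendsto_stripBoundaryIntegral {α β : ℝ} (P : Finset ℝ) (q r : ℝ → ℂ) (F : ℂ → ℂ)
    (hP : ∀ p ∈ P, α < p ∧ p < β) (hαβ : α ≤ β)
    (hd : ∀ s : ℂ, α ≤ s.re → s.re ≤ β → (∀ p ∈ P, s ≠ (p : ℂ)) → DifferentiableAt ℂ F s)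
    (hr : ∀ p ∈ P, Tendsto (fun s : ℂ => (s - p) * (F s - q p / (s - p) ^ 2)) (𝓝[≠] (p : ℂ))
      (𝓝 (r p)))
    (hF : StripDecay α β F) :
    Tendsto (stripBoundaryIntegral α β F) atTop (𝓝 (2 * Real.pi * ∑ p ∈ P, r p)) := by
  classical
  -- Remove one pole at a time: subtract its principal part from `F` and apply the induction
  -- hypothesis to what is left.
  induction P using Finset.induction_on generalizing F with
  | empty => 
    simpa using tendsto_stripBoundaryIntegral_of_differentiableAt hαβ
      (fun s h1 h2 => hd s h1 h2 (by simp)) hF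
  | insert p P hp ih =>
    obtain ⟨hα, hβ⟩ := hP p (Finset.mem_insert_self _ _)
    set pp : ℂ → ℂ := fun s => q p / (s - p) ^ 2 + r p / (s - p) with hpp
    have hppd : ∀ s : ℂ, s ≠ p → DifferentiableAt ℂ pp s := fun s hs => by
      have : s - p ≠ 0 := sub_ne_zero.2 hs
      have h2 : (s - p) ^ 2 ≠ 0 := pow_ne_zero 2 this
      fun_prop (disch := assumption)
    set F₀ : ℂ → ℂ := fun s => F s - pp s with hF₀
    -- Removable singularity: the value at `p` is replaced by the limit there.
    set F₁ : ℂ → ℂ := Function.update F₀ p (limUnder (𝓝[≠] (p : ℂ)) F₀) with hF₁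
    have hF₁ne : ∀ s : ℂ, s ≠ p → F₁ s = F₀ s := fun s hs => Function.update_of_ne hs _ _
    have hpne : ∀ p' ∈ P, (p' : ℂ) ≠ p := fun p' h h' => hp (by
      rwa [← Complex.ofReal_injective h'])
    -- a punctured neighbourhood of `p` on which `F` is differentiable
    have hU : {s : ℂ | α < s.re ∧ s.re < β ∧ ∀ p' ∈ P, s ≠ (p' : ℂ)} ∈ 𝓝 (p : ℂ) := by
      have h1 : ∀ᶠ s : ℂ in 𝓝 (p : ℂ), α < s.re :=
        (isOpen_lt continuous_const Complex.continuous_re).mem_nhds (by simpa using hα)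
      have h2 : ∀ᶠ s : ℂ in 𝓝 (p : ℂ), s.re < β :=
        (isOpen_lt Complex.continuous_re continuous_const).mem_nhds (by simpa using hβ)
      have h3 : ∀ᶠ s : ℂ in 𝓝 (p : ℂ), ∀ p' ∈ P, s ≠ (p' : ℂ) :=
        (Finset.eventually_all P).2 fun p' hp' => eventually_ne_nhds (hpne p' hp').symm
      filter_upwards [h1, h2, h3] with s a b c using ⟨a, b, c⟩
    have hF₁p : DifferentiableAt ℂ F₁ p := by
      refine (Complex.differentiableOn_update_limUnder_of_isLittleO hU ?_ ?_).differentiableAt hU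
      · rintro s ⟨⟨h1, h2, h3⟩, h4⟩
        have h4 : s ≠ p := h4
        refine ((hd s h1.le h2.le fun p' hp' => ?_).sub (hppd s h4)).differentiableWithinAt
        rcases Finset.mem_insert.1 hp' with rfl | h
        · exact h4
        · exact h3 p' h
      · have hz : Tendsto (fun s : ℂ => s - p) (𝓝[≠] (p : ℂ)) (𝓝 0) := by
          have : Tendsto (fun s : ℂ => s - p) (𝓝 (p : ℂ)) (𝓝 ((p : ℂ) - p)) :=
            (continuous_id.sub continuous_const).tendsto _
          rw [sub_self] at this
          exact this.mono_left nhdsWithin_le_nhds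
        refine (Asymptotics.isLittleO_iff_tendsto' ?_).2 ?_
        · filter_upwards [self_mem_nhdsWithin] with s hs h
          exact absurd (inv_eq_zero.1 h) (sub_ne_zero.2 hs)
        -- `F₀ p` is only a fixed constant here; multiplied by `s - p` it tends to `0`, so its
        -- actual value is irrelevant.
        · have h1 := ((hr p (Finset.mem_insert_self _ _)).sub_const (r p)).sub
            (hz.mul_const (F₀ p))
          simp only [sub_self, zero_mul] at h1
          refine h1.congr' ?_
          filter_upwards [self_mem_nhdsWithin] with s hs
          have : s - p ≠ 0 := sub_ne_zero.2 hs
          simp only [hF₀, hpp]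
          field_simp
          ring
    have hF₁d : ∀ s : ℂ, s ≠ p → DifferentiableAt ℂ F₀ s → DifferentiableAt ℂ F₁ s := by
      intro s hs h
      refine h.congr_of_eventuallyEq ?_
      filter_upwards [eventually_ne_nhds hs] with z hz using hF₁ne z hz
    have key := ih F₁ (fun p' hp' => hP p' (Finset.mem_insert_of_mem hp')) ?_ ?_ ?_
    · have hsum := key.add (tendsto_stripBoundaryIntegral_principalPart hα hβ (q p) (r p))
      rw [Finset.sum_insert hp, mul_add, add_comm (2 * (Real.pi : ℂ) * r p)]
      refine hsum.congr fun T => ?_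
      have hcont : ∀ x : ℝ, α ≤ x → x ≤ β → (∀ p' ∈ insert p P, x ≠ p') →
          (∫ v in (-T)..T, F₁ (x + v * Complex.I)) + (∫ v in (-T)..T, pp (x + v * Complex.I)) =
            ∫ v in (-T)..T, F (x + v * Complex.I) := by
        intro x h1 h2 h3
        have hne : ∀ p' ∈ insert p P, ∀ v : ℝ, (x : ℂ) + v * Complex.I ≠ p' :=
          fun p' hp' v h => h3 p' hp' (by simpa using congrArg Complex.re h)
        have hline : ∀ v : ℝ, ContinuousAt (fun v : ℝ => (x : ℂ) + v * Complex.I) v :=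
          fun v => by fun_prop
        have cF : Continuous fun v : ℝ => F (x + v * Complex.I) :=
          continuous_iff_continuousAt.2 fun v =>
            ContinuousAt.comp (f := fun v : ℝ => (x : ℂ) + v * Complex.I)
              (hd _ (by simpa using h1) (by simpa using h2)
                fun p' hp' => hne p' hp' v).continuousAt (hline v)
        have cp : Continuous fun v : ℝ => pp (x + v * Complex.I) :=
          continuous_iff_continuousAt.2 fun v =>
            ContinuousAt.comp (f := fun v : ℝ => (x : ℂ) + v * Complex.I)
              (hppd _ (hne p (Finset.mem_insert_self _ _) v)).continuousAt (hline v)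
        have e1 : ∀ v : ℝ, F₁ (x + v * Complex.I) =
            F (x + v * Complex.I) - pp (x + v * Complex.I) := fun v =>
          hF₁ne _ (hne p (Finset.mem_insert_self _ _) v)
        simp only [e1]
        rw [intervalIntegral.integral_sub (cF.intervalIntegrable _ _) (cp.intervalIntegrable _ _)]
        ring
      have i1 := hcont β hαβ le_rfl fun p' hp' => (hP p' hp').2.ne'
      have i2 := hcont α le_rfl hαβ fun p' hp' => (hP p' hp').1.ne
      simp only [stripBoundaryIntegral]
      rw [← i1, ← i2]; ring
    · intro s h1 h2 h3
      by_cases hs : s = p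
      · rw [hs]; exact hF₁p
      · refine hF₁d s hs ((hd s h1 h2 fun p' hp' => ?_).sub (hppd s hs))
        rcases Finset.mem_insert.1 hp' with rfl | h
        · exact hs
        · exact h3 p' h
    · intro p' hp'
      -- The subtracted principal part is regular at every other pole and does not change the
      -- residue there.
      have hz : Tendsto (fun s : ℂ => (s - p') * pp s) (𝓝[≠] (p' : ℂ)) (𝓝 0) := by
        have : ContinuousAt (fun s : ℂ => (s - p') * pp s) p' :=
          (continuousAt_id.sub continuousAt_const).mul (hppd _ (hpne p' hp')).continuousAt
        have := this.tendsto
        simp only [sub_self, zero_mul] at this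
        exact this.mono_left nhdsWithin_le_nhds
      have := (hr p' (Finset.mem_insert_of_mem hp')).sub hz
      rw [sub_zero] at this
      refine this.congr' ?_
      filter_upwards [nhdsWithin_le_nhds (eventually_ne_nhds (hpne p' hp'))] with s hs
      rw [hF₁ne s hs]
      simp only [hF₀]; ring
    · refine (hF.sub ((stripDecay_div_pow α β p (q p) two_ne_zero).add
        (stripDecay_div_pow α β p (r p) one_ne_zero))).congr fun s hs => ?_
      rw [hF₁ne s (by rintro rfl; simp at hs)]
      simp [hF₀, hpp]

/-- Residue theorem for a strip, with absolutely convergent integrals over both edges. -/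
theorem integral_strip_sub_eq {α β : ℝ} (P : Finset ℝ) (q r : ℝ → ℂ) (F : ℂ → ℂ)
    (hP : ∀ p ∈ P, α < p ∧ p < β) (hαβ : α ≤ β)
    (hd : ∀ s : ℂ, α ≤ s.re → s.re ≤ β → (∀ p ∈ P, s ≠ (p : ℂ)) → DifferentiableAt ℂ F s)
    (hr : ∀ p ∈ P, Tendsto (fun s : ℂ => (s - p) * (F s - q p / (s - p) ^ 2)) (𝓝[≠] (p : ℂ))
      (𝓝 (r p)))
    (hF : StripDecay α β F) (hα : Integrable fun v : ℝ => F (α + v * Complex.I))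
    (hβ : Integrable fun v : ℝ => F (β + v * Complex.I)) :
    (∫ v : ℝ, F (β + v * Complex.I)) - (∫ v : ℝ, F (α + v * Complex.I)) =
      2 * Real.pi * ∑ p ∈ P, r p := by
  refine tendsto_nhds_unique ?_ (tendsto_stripBoundaryIntegral P q r F hP hαβ hd hr hF)
  exact (intervalIntegral_tendsto_integral hβ tendsto_neg_atTop_atBot tendsto_id).sub
    (intervalIntegral_tendsto_integral hα tendsto_neg_atTop_atBot tendsto_id)

/-! ### Linear growth of `ζ` against exponential decay of the kernel -/

lemma norm_riemannZeta_le {s : ℂ} {a δ : ℝ} (ha : 0 < a) (hδ : 0 < δ) (hs : a ≤ s.re)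
    (hs1 : δ ≤ ‖s - 1‖) : ‖riemannZeta s‖ ≤ (δ⁻¹ + 2 + a⁻¹) * (1 + |s.im|) := by
  have hne : s ≠ 1 := by rintro rfl; simp at hs1; linarith
  have hre : 0 < s.re := ha.trans_le hs
  rw [riemannZeta_eq_inv_sub_add hne]
  have h1 : ‖(s - 1)⁻¹‖ ≤ δ⁻¹ := by
    rw [norm_inv]; exact inv_anti₀ hδ hs1
  have h2 : ‖s‖ / s.re ≤ 1 + |s.im| * a⁻¹ := by
    have h3 := Complex.norm_le_abs_re_add_abs_im s
    rw [abs_of_pos hre] at h3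
    calc ‖s‖ / s.re ≤ (s.re + |s.im|) / s.re := by gcongr
      _ = 1 + |s.im| * s.re⁻¹ := by field_simp
      _ ≤ 1 + |s.im| * a⁻¹ := by gcongr
  have h4 := norm_riemannZeta₀_le hre
  refine (norm_add_le _ _).trans ?_
  have h5 : 0 ≤ |s.im| * (δ⁻¹ + 2) := by positivity
  have h6 : 0 < a⁻¹ := inv_pos.2 ha
  nlinarith

/-- Fourth power of `1 + t ≤ (1 + 4/κ) exp(κt/4)`: two factors `1 + t` absorb the growth of a
product of two zetas, the other two leave an integrable majorant. -/
lemma one_add_sq_mul_exp_neg_le {κ : ℝ} (hκ : 0 < κ) {t : ℝ} (ht : 0 ≤ t) :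
    (1 + t) ^ 2 * Real.exp (-(κ * t)) ≤ (1 + 4 / κ) ^ 4 / (1 + t ^ 2) := by
  have h1 : 1 + t ≤ (1 + 4 / κ) * Real.exp (κ * t / 4) := by
    have e1 := Real.add_one_le_exp (κ * t / 4)
    have e2 : 1 ≤ Real.exp (κ * t / 4) := Real.one_le_exp (by positivity)
    have e3 : 4 / κ * (κ * t / 4) = t := by field_simp
    have e4 : 4 / κ * (κ * t / 4) ≤ 4 / κ * Real.exp (κ * t / 4) := by
      gcongr; linarith
    nlinarith
  have h2 : (1 + t) ^ 4 ≤ (1 + 4 / κ) ^ 4 * Real.exp (κ * t) := by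
    calc (1 + t) ^ 4 ≤ ((1 + 4 / κ) * Real.exp (κ * t / 4)) ^ 4 := by gcongr
      _ = _ := by
        rw [mul_pow, ← Real.exp_nat_mul]; congr 2; push_cast; ring
  rw [le_div_iff₀ (by positivity), Real.exp_neg, ← div_eq_mul_inv, div_mul_eq_mul_div,
    div_le_iff₀ (Real.exp_pos _)]
  refine le_trans ?_ h2
  nlinarith [mul_nonneg ht (sq_nonneg (1 + t))]

/-- One exponential in `cos z` has norm `exp |im z|`, the other at most `1`; which is which depends
on the sign of `im z`. -/
lemma norm_cos_ge {z : ℂ} (hz : 1 ≤ |z.im|) : Real.exp |z.im| / 4 ≤ ‖Complex.cos z‖ := by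
  have key : ∀ u w : ℂ, ‖u‖ = Real.exp |z.im| → ‖w‖ = Real.exp (-|z.im|) →
      Real.exp |z.im| / 4 ≤ ‖(u + w) / 2‖ := by
    intro u w hu hw
    have h1 : ‖u‖ - ‖w‖ ≤ ‖u + w‖ := by
      simpa using norm_sub_norm_le u (-w)
    have h2 : Real.exp (-|z.im|) ≤ 1 := Real.exp_le_one_iff.2 (by simp)
    have h3 := Real.add_one_le_exp |z.im|
    rw [norm_div, Complex.norm_ofNat]
    rw [hu, hw] at h1
    linarith
  rw [Complex.cos]
  rcases le_total 0 z.im with h | h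
  · rw [add_comm]
    refine key _ _ ?_ ?_ <;> rw [Complex.norm_exp] <;> simp [abs_of_nonneg h]
  · refine key _ _ ?_ ?_ <;> rw [Complex.norm_exp] <;> simp [abs_of_nonpos h]

lemma exp_div_two_le_norm_cosh (x : ℝ) : Real.exp |x| / 2 ≤ ‖Complex.cosh (x : ℂ)‖ := by
  rw [← Complex.ofReal_cosh, Complex.norm_real, Real.norm_of_nonneg (Real.cosh_pos x).le,
    ← Real.cosh_abs, Real.cosh_eq]
  have := Real.exp_pos (-|x|)
  linarith

lemma cosh_ofReal_ne_zero (x : ℝ) : Complex.cosh (x : ℂ) ≠ 0 := by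
  rw [← Complex.ofReal_cosh]
  exact_mod_cast (Real.cosh_pos x).ne'

lemma norm_mul_div_cosh_le {b M : ℝ} (hb : 0 < b) {v : ℝ} {z w : ℂ}
    (hz : ‖z‖ ≤ M * (1 + |v|)) (hw : ‖w‖ ≤ M * (1 + |v|)) :
    ‖z * w / Complex.cosh (Real.pi * v / b)‖ ≤
      2 * M ^ 2 * (1 + 4 / (Real.pi / b)) ^ 4 * (1 + v ^ 2)⁻¹ := by
  have h1 := exp_div_two_le_norm_cosh (Real.pi * v / b)
  have h2 := one_add_sq_mul_exp_neg_le (div_pos Real.pi_pos hb) (abs_nonneg v)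
  have h3 : |Real.pi * v / b| = Real.pi / b * |v| := by
    rw [abs_div, abs_mul, abs_of_pos hb, abs_of_pos Real.pi_pos]; ring
  rw [h3] at h1
  push_cast at h1
  rw [sq_abs] at h2
  have hM : 0 ≤ M * (1 + |v|) := (norm_nonneg z).trans hz
  rw [norm_div, norm_mul]
  calc ‖z‖ * ‖w‖ / ‖Complex.cosh (Real.pi * v / b)‖
      ≤ (M * (1 + |v|)) * (M * (1 + |v|)) / (Real.exp (Real.pi / b * |v|) / 2) := by gcongr
    _ = 2 * M ^ 2 * ((1 + |v|) ^ 2 * Real.exp (-(Real.pi / b * |v|))) := by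
        rw [Real.exp_neg]; field_simp
    _ ≤ 2 * M ^ 2 * ((1 + 4 / (Real.pi / b)) ^ 4 / (1 + v ^ 2)) := by gcongr
    _ = _ := by ring

lemma integrable_mul_div_cosh {b M : ℝ} (hb : 0 < b) {f g : ℝ → ℂ} (hf : Continuous f)
    (hg : Continuous g) (hfM : ∀ v, ‖f v‖ ≤ M * (1 + |v|)) (hgM : ∀ v, ‖g v‖ ≤ M * (1 + |v|)) :
    Integrable fun v : ℝ => f v * g v / Complex.cosh (Real.pi * v / b) := by
  refine Integrable.mono' (integrable_inv_one_add_sq.const_mul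
    (2 * M ^ 2 * (1 + 4 / (Real.pi / b)) ^ 4)) ?_
    (Eventually.of_forall fun v => norm_mul_div_cosh_le hb (hfM v) (hgM v))
  refine Continuous.aestronglyMeasurable ((hf.mul hg).div ?_ fun v => ?_)
  · exact Complex.continuous_cosh.comp (by fun_prop)
  · have := cosh_ofReal_ne_zero (Real.pi * v / b)
    push_cast at this
    exact this

lemma stripDecay_mul_div_cos {a b M : ℝ} (hb : 0 < b) {f g : ℂ → ℂ}
    (hf : ∀ s : ℂ, a ≤ s.re → s.re ≤ a + b → 1 ≤ |s.im| → ‖f s‖ ≤ M * (1 + |s.im|))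
    (hg : ∀ s : ℂ, a ≤ s.re → s.re ≤ a + b → 1 ≤ |s.im| → ‖g s‖ ≤ M * (1 + |s.im|)) :
    StripDecay a (a + b) fun s => f s * g s / Complex.cos (Real.pi * (s - a) / b) := by
  have hpb := div_pos Real.pi_pos hb
  refine ⟨fun T => 4 * M ^ 2 * ((1 + 4 / (Real.pi / b)) ^ 4 / (1 + T ^ 2)), ?_, ?_⟩
  · have : Tendsto (fun T : ℝ => 1 + T ^ 2) atTop atTop :=
      tendsto_atTop_add_const_left _ _ (tendsto_pow_atTop two_ne_zero)
    simpa using (tendsto_const_nhds.div_atTop this).const_mul (4 * M ^ 2)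
  -- `T ≥ b/π` makes the imaginary part of the cosine's argument at least `1` in absolute value, as
  -- `norm_cos_ge` requires.
  · filter_upwards [eventually_ge_atTop 1, eventually_ge_atTop (b / Real.pi)] with T h1 h2 x hx y hy
    have him : ((x : ℂ) + y * Complex.I).im = y := by simp
    have hre : ((x : ℂ) + y * Complex.I).re = x := by simp
    have e1 := hf (x + y * Complex.I) (by rw [hre]; exact hx.1) (by rw [hre]; exact hx.2)
      (by rw [him, hy]; exact h1)
    have e2 := hg (x + y * Complex.I) (by rw [hre]; exact hx.1) (by rw [hre]; exact hx.2)
      (by rw [him, hy]; exact h1)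
    rw [him, hy] at e1 e2
    have him2 : ((Real.pi * ((x : ℂ) + y * Complex.I - a) / b)).im = Real.pi / b * y := by
      have : (Real.pi * ((x : ℂ) + y * Complex.I - a) / b) =
        ((Real.pi * (x - a) / b : ℝ) : ℂ) + ((Real.pi / b * y : ℝ) : ℂ) * Complex.I := by
        push_cast; ring
      rw [this]; simp
    have habs : |((Real.pi * ((x : ℂ) + y * Complex.I - a) / b)).im| = Real.pi / b * T := by
      rw [him2, abs_mul, hy, abs_of_pos hpb]
    have h3 : 1 ≤ Real.pi / b * T := by
      calc (1 : ℝ) = Real.pi / b * (b / Real.pi) := by field_simp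
        _ ≤ _ := by gcongr
    have e3 := norm_cos_ge (z := Real.pi * ((x : ℂ) + y * Complex.I - a) / b) (by rwa [habs])
    rw [habs] at e3
    have e4 := one_add_sq_mul_exp_neg_le hpb (zero_le_one.trans h1)
    have hM : 0 ≤ M * (1 + T) := (norm_nonneg _).trans e1
    rw [norm_div, norm_mul]
    calc _ ≤ (M * (1 + T)) * (M * (1 + T)) / (Real.exp (Real.pi / b * T) / 4) := by gcongr
      _ = 4 * M ^ 2 * ((1 + T) ^ 2 * Real.exp (-(Real.pi / b * T))) := by
        rw [Real.exp_neg]; field_simp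
      _ ≤ _ := by gcongr

/-! ### The kernel and `ζ` on the strip and its edges -/

/-- The zeros are `a + (2k + 1)b/2` with `k` an integer, and only `k = 0` falls in the strip. -/
lemma cos_pi_mul_sub_div_ne_zero {a b : ℝ} (hb : 0 < b) {s : ℂ} (h1 : a ≤ s.re)
    (h2 : s.re ≤ a + b) (hs : s ≠ ((a + b / 2 : ℝ) : ℂ)) :
    Complex.cos (Real.pi * (s - a) / b) ≠ 0 := by
  refine Complex.cos_ne_zero_iff.2 fun k hk => ?_
  have hb' : (b : ℂ) ≠ 0 := by exact_mod_cast hb.ne'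
  have hpi : (Real.pi : ℂ) ≠ 0 := by exact_mod_cast Real.pi_ne_zero
  have e : s = ((a + (2 * k + 1) * b / 2 : ℝ) : ℂ) := by
    field_simp at hk
    push_cast
    linear_combination hk / 2
  have hre : s.re = a + (2 * k + 1) * b / 2 := by rw [e, Complex.ofReal_re]
  rw [hre] at h1 h2
  have k1 : (-1 : ℝ) < k := by
    by_contra! h; nlinarith
  have k2 : (k : ℝ) < 1 := by
    by_contra! h; nlinarith
  have k0 : k = 0 := by
    have k1' : -1 < k := by exact_mod_cast k1
    have k2' : k < 1 := by exact_mod_cast k2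
    omega
  apply hs
  rw [e, k0]
  congr 1
  push_cast
  ring

lemma hasDerivAt_cos_pi_mul_sub_div (a b : ℝ) (s : ℂ) :
    HasDerivAt (fun s : ℂ => Complex.cos (Real.pi * (s - a) / b))
      (-Complex.sin (Real.pi * (s - a) / b) * (Real.pi / b)) s := by
  have h : HasDerivAt (fun s : ℂ => Real.pi * (s - a) / b) ((Real.pi : ℂ) / b) s := by
    simpa using (((hasDerivAt_id' s).sub_const (a : ℂ)).const_mul (Real.pi : ℂ)).div_const (b : ℂ)
  exact h.ccos

/-- The simple pole of `1 / cos` in the middle of the strip. -/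
lemma tendsto_sub_mul_inv_cos {a b : ℝ} (hb : 0 < b) :
    Tendsto (fun s : ℂ => (s - ((a + b / 2 : ℝ) : ℂ)) * (Complex.cos (Real.pi * (s - a) / b))⁻¹)
      (𝓝[≠] ((a + b / 2 : ℝ) : ℂ)) (𝓝 (-(b / Real.pi))) := by
  have hb' : (b : ℂ) ≠ 0 := by exact_mod_cast hb.ne'
  have hpi : (Real.pi : ℂ) ≠ 0 := by exact_mod_cast Real.pi_ne_zero
  have harg : (Real.pi * (((a + b / 2 : ℝ) : ℂ) - a) / b) = (Real.pi : ℂ) / 2 := by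
    push_cast; field_simp; ring
  have h := hasDerivAt_iff_tendsto_slope.1
    (hasDerivAt_cos_pi_mul_sub_div a b ((a + b / 2 : ℝ) : ℂ))
  rw [harg, Complex.sin_pi_div_two] at h
  have h2 := h.inv₀ (by simp [hb', hpi])
  have e : (-1 * ((Real.pi : ℂ) / b))⁻¹ = -(b / Real.pi) := by
    field_simp
  rw [e] at h2
  refine h2.congr fun s => ?_
  rw [slope_def_field, harg, Complex.cos_pi_div_two, sub_zero, inv_div, div_eq_mul_inv]

lemma continuous_riemannZeta_line {x : ℝ} (hx : x ≠ 1) (σ : ℂ) (hσ : σ.re = 0) :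
    Continuous fun v : ℝ => riemannZeta (x + σ * v) := by
  refine continuous_iff_continuousAt.2 fun v => ?_
  have hne : (x : ℂ) + σ * v ≠ 1 := fun h => hx (by
    simpa [hσ] using congrArg Complex.re h)
  exact ContinuousAt.comp (f := fun v : ℝ => (x : ℂ) + σ * v)
    (differentiableAt_riemannZeta hne).continuousAt (by fun_prop)

lemma norm_riemannZeta_line_le {a x δ : ℝ} (ha : 0 < a) (hx : a ≤ x) (hδ : 0 < δ)
    (hx1 : δ ≤ |x - 1|) {σ : ℂ} (hσ : σ.re = 0) (hσ1 : |σ.im| = 1) (v : ℝ) :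
    ‖riemannZeta (x + σ * v)‖ ≤ (δ⁻¹ + 2 + a⁻¹) * (1 + |v|) := by
  have h := norm_riemannZeta_le (s := x + σ * v) ha hδ (by simpa [hσ] using hx)
    (hx1.trans (by simpa [hσ] using Complex.abs_re_le_norm ((x : ℂ) + σ * v - 1)))
  simpa [hσ, abs_mul, hσ1] using h

lemma norm_riemannZeta_le_of_one_le_abs_im {a : ℝ} (ha : 0 < a) {s : ℂ} (hs : a ≤ s.re)
    (hs1 : 1 ≤ |s.im|) : ‖riemannZeta s‖ ≤ (1⁻¹ + 2 + a⁻¹) * (1 + |s.im|) :=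
  norm_riemannZeta_le ha one_pos hs
    (hs1.trans (by simpa using Complex.abs_im_le_norm (s - 1)))

lemma cos_left_edge (a b v : ℝ) :
    Complex.cos (Real.pi * ((a : ℂ) + v * Complex.I - a) / b) =
      Complex.cosh (Real.pi * v / b) := by
  rw [← Complex.cos_mul_I]; congr 1; ring

/-- Crossing the strip shifts the argument by `π`; this sign makes the two edge integrals add up. -/
lemma cos_right_edge {b : ℝ} (hb : 0 < b) (a v : ℝ) :
    Complex.cos (Real.pi * (((a + b : ℝ) : ℂ) + v * Complex.I - a) / b) =
      -Complex.cosh (Real.pi * v / b) := by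
  have hb' : (b : ℂ) ≠ 0 := by exact_mod_cast hb.ne'
  rw [← Complex.cos_mul_I, ← Complex.cos_add_pi]; congr 1; push_cast; field_simp; ring

/-! ### Evaluation of the integrals by residues -/

section Edges

variable {a b : ℝ}

lemma integrable_riemannZeta_mul_div_cosh (ha : 0 < a) (ha1 : a < 1) (hab : 1 < a + b) :
    Integrable (fun v : ℝ => riemannZeta (a + Complex.I * v) * riemannZeta (a + b - Complex.I * v)
      / Complex.cosh (Real.pi * v / b)) ∧
    Integrable (fun v : ℝ => riemannZeta (a + Complex.I * v) * riemannZeta (a + Complex.I * v)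
      / Complex.cosh (Real.pi * v / b)) ∧
    Integrable (fun v : ℝ => riemannZeta (a + b - Complex.I * v) *
      riemannZeta (a + b - Complex.I * v) / Complex.cosh (Real.pi * v / b)) := by
  have hb : 0 < b := by linarith
  have e : (fun v : ℝ => riemannZeta (a + b - Complex.I * v)) =
      fun v : ℝ => riemannZeta ((a + b : ℝ) + (-Complex.I) * v) := by
    funext v; push_cast; ring_nf
  have cX := continuous_riemannZeta_line ha1.ne Complex.I Complex.I_re
  have cY := continuous_riemannZeta_line hab.ne' (-Complex.I) (by simp)
  -- The smaller of the distances from the pole `1` to the two edges.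
  have hδ : 0 < min (1 - a) (a + b - 1) := lt_min (by linarith) (by linarith)
  have bX := norm_riemannZeta_line_le (x := a) ha le_rfl hδ
    ((min_le_left _ _).trans (by rw [abs_sub_comm]; exact le_abs_self _))
    Complex.I_re (by simp)
  have bY := norm_riemannZeta_line_le (x := a + b) (σ := -Complex.I) ha (by linarith) hδ
    ((min_le_right _ _).trans (le_abs_self _)) (by simp) (by simp)
  rw [← e] at cY
  have bY' : ∀ v : ℝ, ‖riemannZeta (a + b - Complex.I * v)‖ ≤
      ((min (1 - a) (a + b - 1))⁻¹ + 2 + a⁻¹) * (1 + |v|) := fun v =>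
    (congrArg norm (congrFun e v)).trans_le (bY v)
  exact ⟨integrable_mul_div_cosh hb cX cY bX bY', integrable_mul_div_cosh hb cX cX bX bX,
    integrable_mul_div_cosh hb cY cY bY' bY'⟩

/-- This is the kernel's denominator at `s = 1`, a point of the strip other than its midpoint. -/
lemma cos_div_ne_zero (ha1 : a < 1) (hab : 1 < a + b) (hne : a ≠ 1 - b / 2) :
    Complex.cos (Real.pi * (1 - a) / b) ≠ 0 := by
  refine cos_pi_mul_sub_div_ne_zero (s := 1) (by linarith) (by simpa using ha1.le)
    (by simpa using hab.le) fun h => hne ?_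
  have h' : (1 : ℝ) = a + b / 2 := by exact_mod_cast h
  linarith

lemma cos_pi_mul_neg_div (a b : ℝ) :
    Complex.cos (Real.pi * (1 - a) / b) = Complex.cos (Real.pi * (a - 1) / b) := by
  rw [← Complex.cos_neg]; congr 1; ring

lemma sin_pi_mul_neg_div (a b : ℝ) :
    Complex.sin (Real.pi * (1 - a) / b) = -Complex.sin (Real.pi * (a - 1) / b) := by
  rw [← Complex.sin_neg]; congr 1; ring

lemma differentiableAt_inv_cos (hb : 0 < b) {s : ℂ} (h1 : a ≤ s.re)
    (h2 : s.re ≤ a + b) (hs : s ≠ ((a + b / 2 : ℝ) : ℂ)) :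
    DifferentiableAt ℂ (fun s : ℂ => (Complex.cos (Real.pi * (s - a) / b))⁻¹) s :=
  (hasDerivAt_cos_pi_mul_sub_div a b s).differentiableAt.inv
    (cos_pi_mul_sub_div_ne_zero hb h1 h2 hs)

theorem integral_riemannZeta_mul_div_cosh (ha : 0 < a) (ha1 : a < 1) (hab : 1 < a + b)
    (hne : a ≠ 1 - b / 2) :
    ∫ v : ℝ, riemannZeta (a + Complex.I * v) * riemannZeta (a + b - Complex.I * v)
        / Complex.cosh (Real.pi * v / b) =
      b * riemannZeta (a + b / 2) ^ 2
        - 2 * Real.pi * riemannZeta (2 * a - 1 + b) / Complex.cos (Real.pi * (a - 1) / b) := by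
  have hb : 0 < b := by linarith
  have hb' : (b : ℂ) ≠ 0 := by exact_mod_cast hb.ne'
  have hpi : (Real.pi : ℂ) ≠ 0 := by exact_mod_cast Real.pi_ne_zero
  obtain ⟨hI, -, -⟩ := integrable_riemannZeta_mul_div_cosh ha ha1 hab
  set F : ℂ → ℂ := fun s => riemannZeta s * riemannZeta (2 * a + b - s) /
    Complex.cos (Real.pi * (s - a) / b) with hFdef
  set G : ℝ → ℂ := fun v => riemannZeta (a + Complex.I * v) * riemannZeta (a + b - Complex.I * v)
    / Complex.cosh (Real.pi * v / b) with hGdef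
  have hleft : ∀ v : ℝ, F (a + v * Complex.I) = G v := fun v => by
    simp only [hFdef, hGdef, cos_left_edge]
    congr 3 <;> ring
  have hright : ∀ v : ℝ, F ((a + b : ℝ) + v * Complex.I) = -G (-v) := fun v => by
    simp only [hFdef, hGdef, cos_right_edge hb, div_neg]
    push_cast
    have e1 : (Real.pi : ℂ) * -v / b = -(Real.pi * v / b) := by ring
    rw [e1, Complex.cosh_neg, mul_comm]
    congr 4 <;> ring
  have hm1 : (1 : ℂ) ≠ ((a + b / 2 : ℝ) : ℂ) := fun h => hne (by
    have h' : (1 : ℝ) = a + b / 2 := by exact_mod_cast h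
    linarith)
  have hm1' : (1 : ℝ) ≠ a + b / 2 := fun h => hne (by linarith)
  have hcm' : 2 * a + b - 1 ≠ a + b / 2 := fun h => hne (by linarith)
  have h1c' : (1 : ℝ) ≠ 2 * a + b - 1 := fun h => hne (by linarith)
  have hcm : ((2 * a + b - 1 : ℝ) : ℂ) ≠ ((a + b / 2 : ℝ) : ℂ) := by exact_mod_cast hcm'
  have h1c : (1 : ℂ) ≠ ((2 * a + b - 1 : ℝ) : ℂ) := by exact_mod_cast h1c'
  -- The residue at `1`, and also at `2a + b - 1`: there both `ζ(2a + b - s)` and the cosine bring a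
  -- minus sign.
  set R : ℂ := riemannZeta (2 * a + b - 1) / Complex.cos (Real.pi * (1 - a) / b) with hR
  set S : ℂ := riemannZeta (a + b / 2) * riemannZeta (a + b / 2) * -(b / Real.pi) with hS
  have hcont : ∀ s : ℂ, s ≠ 2 * a + b - 1 →
      DifferentiableAt ℂ (fun s : ℂ => riemannZeta (2 * a + b - s)) s := fun s hs =>
    DifferentiableAt.comp (f := fun s : ℂ => 2 * a + b - s) s
      (differentiableAt_riemannZeta fun h => hs (by linear_combination -h))
      ((differentiableAt_const _).sub differentiableAt_id)
  have key := integral_strip_sub_eq (α := a) (β := a + b) {1, 2 * a + b - 1, a + b / 2}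
    (fun _ => 0) (fun p => if p = a + b / 2 then S else R) F ?_ (by linarith) ?_ ?_ ?_ ?_ ?_
  · simp only [hleft, hright] at key
    rw [integral_neg, integral_neg_eq_self G, Finset.sum_insert (by simp [h1c', hm1']),
      Finset.sum_insert (by simp [hcm']), Finset.sum_singleton, if_neg hm1', if_neg hcm',
      if_pos rfl] at key
    have e2 : (2 * a - 1 + b : ℂ) = 2 * a + b - 1 := by ring
    rw [e2, ← cos_pi_mul_neg_div, mul_div_assoc]
    have e3 : S = -(riemannZeta (a + b / 2) ^ 2 * b / Real.pi) := by rw [hS]; ring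
    rw [e3] at key
    have e4 : (Real.pi : ℂ) * (riemannZeta (a + b / 2) ^ 2 * b / Real.pi) =
      b * riemannZeta (a + b / 2) ^ 2 := by field_simp
    linear_combination (-1 / 2) * key + e4
  · intro p hp
    simp only [Finset.mem_insert, Finset.mem_singleton] at hp
    rcases hp with rfl | rfl | rfl <;> constructor <;> linarith
  · intro s h1 h2 hs
    have hs1 : s ≠ 1 := by simpa using hs 1 (by simp)
    have hsc : s ≠ 2 * a + b - 1 := by simpa using hs (2 * a + b - 1) (by simp)
    have hsm := hs (a + b / 2) (by simp)
    simp only [hFdef, div_eq_mul_inv]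
    exact ((differentiableAt_riemannZeta hs1).mul (hcont s hsc)).mul
      (differentiableAt_inv_cos hb h1 h2 hsm)
  · intro p hp
    simp only [Finset.mem_insert, Finset.mem_singleton] at hp
    simp only [zero_div, sub_zero]
    rcases hp with rfl | rfl | rfl
    · rw [if_neg hm1']
      have hc : ContinuousAt (fun s : ℂ => riemannZeta (2 * a + b - s) *
          (Complex.cos (Real.pi * (s - a) / b))⁻¹) 1 :=
        ((hcont 1 (by simpa using h1c)).mul (differentiableAt_inv_cos hb (by simpa using ha1.le)
          (by simpa using hab.le) hm1)).continuousAt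
      have := riemannZeta_residue_one.mul (hc.tendsto.mono_left nhdsWithin_le_nhds)
      rw [one_mul, ← div_eq_mul_inv] at this
      push_cast
      refine this.congr fun s => ?_
      simp only [hFdef]; ring
    · rw [if_neg hcm']
      have hc : ContinuousAt (fun s : ℂ => -(riemannZeta s *
          (Complex.cos (Real.pi * (s - a) / b))⁻¹)) ((2 * a + b - 1 : ℝ) : ℂ) :=
        ((differentiableAt_riemannZeta h1c.symm).mul (differentiableAt_inv_cos hb
          (by rw [Complex.ofReal_re]; linarith) (by rw [Complex.ofReal_re]; linarith)
          hcm)).neg.continuousAt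
      have hsub : Tendsto (fun s : ℂ => 2 * a + b - s) (𝓝[≠] ((2 * a + b - 1 : ℝ) : ℂ))
          (𝓝[≠] 1) := by
        refine tendsto_nhdsWithin_iff.2 ⟨?_, ?_⟩
        · have : Tendsto (fun s : ℂ => 2 * a + b - s) (𝓝 ((2 * a + b - 1 : ℝ) : ℂ))
              (𝓝 (2 * a + b - ((2 * a + b - 1 : ℝ) : ℂ))) :=
            (continuous_const.sub continuous_id).tendsto _
          have e : (2 * a + b - ((2 * a + b - 1 : ℝ) : ℂ)) = 1 := by push_cast; ring
          rw [e] at this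
          exact this.mono_left nhdsWithin_le_nhds
        · filter_upwards [self_mem_nhdsWithin] with s hs h
          have h : 2 * a + b - s = 1 := h
          exact hs (by push_cast; show s = _; linear_combination -h)
      have := (riemannZeta_residue_one.comp hsub).mul (hc.tendsto.mono_left nhdsWithin_le_nhds)
      have e : (1 : ℂ) * -(riemannZeta ((2 * a + b - 1 : ℝ) : ℂ) *
          (Complex.cos (Real.pi * (((2 * a + b - 1 : ℝ) : ℂ) - a) / b))⁻¹) = R := by
        have e1 : (Real.pi * (((2 * a + b - 1 : ℝ) : ℂ) - a) / b) =
            Real.pi - Real.pi * (1 - a) / b := by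
          push_cast; field_simp; ring
        rw [e1, Complex.cos_pi_sub, hR]
        push_cast
        rw [inv_neg, div_eq_mul_inv]; ring
      rw [e] at this
      refine this.congr fun s => ?_
      simp only [hFdef, Function.comp]
      push_cast
      ring
    · rw [if_pos rfl]
      have hc : ContinuousAt (fun s : ℂ => riemannZeta s * riemannZeta (2 * a + b - s))
          ((a + b / 2 : ℝ) : ℂ) :=
        ((differentiableAt_riemannZeta hm1.symm).mul
          (hcont _ (by simpa using hcm.symm))).continuousAt
      have := (hc.tendsto.mono_left nhdsWithin_le_nhds).mul (tendsto_sub_mul_inv_cos (a := a) hb)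
      have e : (2 * a + b - ((a + b / 2 : ℝ) : ℂ)) = a + b / 2 := by push_cast; ring
      rw [e] at this
      have e' : ((a + b / 2 : ℝ) : ℂ) = a + b / 2 := by push_cast; ring
      rw [e'] at this ⊢
      refine this.congr fun s => ?_
      simp only [hFdef]; ring
  · refine stripDecay_mul_div_cos (M := 1⁻¹ + 2 + a⁻¹) hb
      (fun s h1 _ h3 => norm_riemannZeta_le_of_one_le_abs_im ha h1 h3) fun s h1 h2 h3 => ?_
    have := norm_riemannZeta_le_of_one_le_abs_im (s := 2 * a + b - s) ha
      (by simp; linarith) (by simpa using h3)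
    simpa using this
  · simpa only [hleft] using hI
  · simp only [hright]
    exact hI.comp_neg.neg

theorem integral_riemannZeta_sq_add_div_cosh (ha : 0 < a) (ha1 : a < 1) (hab : 1 < a + b)
    (hne : a ≠ 1 - b / 2) :
    (∫ v : ℝ, riemannZeta (a + Complex.I * v) * riemannZeta (a + Complex.I * v)
        / Complex.cosh (Real.pi * v / b)) +
      (∫ v : ℝ, riemannZeta (a + b - Complex.I * v) * riemannZeta (a + b - Complex.I * v)
        / Complex.cosh (Real.pi * v / b)) =
      2 * b * riemannZeta (a + b / 2) ^ 2
        - 4 * Real.eulerMascheroniConstant * Real.pi / Complex.cos (Real.pi * (a - 1) / b)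
        + 2 * Real.pi ^ 2 / b
          * (Complex.sin (Real.pi * (a - 1) / b) / Complex.cos (Real.pi * (a - 1) / b) ^ 2) := by
  have hb : 0 < b := by linarith
  have hb' : (b : ℂ) ≠ 0 := by exact_mod_cast hb.ne'
  have hpi : (Real.pi : ℂ) ≠ 0 := by exact_mod_cast Real.pi_ne_zero
  obtain ⟨-, hX, hY⟩ := integrable_riemannZeta_mul_div_cosh ha ha1 hab
  have hcos := cos_div_ne_zero ha1 hab hne
  set F : ℂ → ℂ := fun s => riemannZeta s * riemannZeta s /
    Complex.cos (Real.pi * (s - a) / b) with hFdef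
  set X : ℝ → ℂ := fun v => riemannZeta (a + Complex.I * v) * riemannZeta (a + Complex.I * v)
    / Complex.cosh (Real.pi * v / b) with hXdef
  set Y : ℝ → ℂ := fun v => riemannZeta (a + b - Complex.I * v) *
    riemannZeta (a + b - Complex.I * v) / Complex.cosh (Real.pi * v / b) with hYdef
  have hleft : ∀ v : ℝ, F (a + v * Complex.I) = X v := fun v => by
    simp only [hFdef, hXdef, cos_left_edge]
    congr 3 <;> ring
  have hright : ∀ v : ℝ, F ((a + b : ℝ) + v * Complex.I) = -Y (-v) := fun v => by
    simp only [hFdef, hYdef, cos_right_edge hb, div_neg]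
    push_cast
    have e1 : (Real.pi : ℂ) * -v / b = -(Real.pi * v / b) := by ring
    rw [e1, Complex.cosh_neg]
    congr 4 <;> ring
  have hm1' : (1 : ℝ) ≠ a + b / 2 := fun h => hne (by linarith)
  have hm1 : (1 : ℂ) ≠ ((a + b / 2 : ℝ) : ℂ) := by exact_mod_cast hm1'
  set C : ℂ := Complex.cos (Real.pi * (1 - a) / b) with hC
  -- The derivative of `1/cos(π(s - a)/b)` at `s = 1`. With the double pole of `ζ²` it enters the
  -- residue next to `2γ/C`.
  set D : ℂ := Complex.sin (Real.pi * (1 - a) / b) * (Real.pi / b) / C ^ 2 with hD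
  set R : ℂ := D + 2 * Real.eulerMascheroniConstant * C⁻¹ with hR
  set S : ℂ := riemannZeta (a + b / 2) * riemannZeta (a + b / 2) * -(b / Real.pi) with hS
  have key := integral_strip_sub_eq (α := a) (β := a + b) {1, a + b / 2}
    (fun p => if p = a + b / 2 then 0 else C⁻¹)
    (fun p => if p = a + b / 2 then S else R) F ?_ (by linarith) ?_ ?_ ?_ ?_ ?_
  · simp only [hleft, hright] at key
    rw [integral_neg, integral_neg_eq_self Y, Finset.sum_insert (by simp [hm1']),
      Finset.sum_singleton, if_neg hm1', if_pos rfl] at key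
    rw [← cos_pi_mul_neg_div, ← neg_eq_iff_eq_neg.2 (sin_pi_mul_neg_div a b), ← hC]
    have e3 : S = -(riemannZeta (a + b / 2) ^ 2 * b / Real.pi) := by rw [hS]; ring
    rw [e3, hR, hD] at key
    have e4 : (Real.pi : ℂ) * (riemannZeta (a + b / 2) ^ 2 * b / Real.pi) =
      b * riemannZeta (a + b / 2) ^ 2 := by field_simp
    linear_combination (-1) * key + 2 * e4
  · intro p hp
    simp only [Finset.mem_insert, Finset.mem_singleton] at hp
    rcases hp with rfl | rfl <;> constructor <;> linarith
  · intro s h1 h2 hs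
    have hs1 : s ≠ 1 := by simpa using hs 1 (by simp)
    have hsm := hs (a + b / 2) (by simp)
    simp only [hFdef, div_eq_mul_inv]
    exact ((differentiableAt_riemannZeta hs1).mul (differentiableAt_riemannZeta hs1)).mul
      (differentiableAt_inv_cos hb h1 h2 hsm)
  · intro p hp
    simp only [Finset.mem_insert, Finset.mem_singleton] at hp
    rcases hp with rfl | rfl
    · rw [if_neg hm1', if_neg hm1']
      set k : ℂ → ℂ := fun s => (Complex.cos (Real.pi * (s - a) / b))⁻¹ with hk
      have hkd : HasDerivAt k D 1 := by
        refine ((hasDerivAt_cos_pi_mul_sub_div a b 1).inv hcos).congr_deriv ?_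
        rw [hD, neg_mul, neg_neg]
      have h1 := hasDerivAt_iff_tendsto_slope.1 hkd
      have hkc : Tendsto k (𝓝[≠] 1) (𝓝 C⁻¹) := hkd.continuousAt.tendsto.mono_left nhdsWithin_le_nhds
      have hz : Tendsto riemannZeta₀ (𝓝[≠] 1) (𝓝 Real.eulerMascheroniConstant) := by
        have := differentiable_riemannZeta₀.continuous.tendsto 1
        rw [riemannZeta₀_one] at this
        exact this.mono_left nhdsWithin_le_nhds
      have hw : Tendsto (fun s : ℂ => s - 1) (𝓝[≠] 1) (𝓝 0) := by
        have : Tendsto (fun s : ℂ => s - 1) (𝓝 1) (𝓝 (1 - 1)) :=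
          (continuous_id.sub continuous_const).tendsto _
        rw [sub_self] at this
        exact this.mono_left nhdsWithin_le_nhds
      have := (h1.add ((hz.const_mul 2).mul hkc)).add ((hw.mul (hz.mul hz)).mul hkc)
      rw [zero_mul, zero_mul, add_zero] at this
      push_cast
      refine this.congr' ?_
      filter_upwards [self_mem_nhdsWithin] with s hs
      have hs1 : s ≠ 1 := hs
      have hs0 : s - 1 ≠ 0 := sub_ne_zero.2 hs1
      have hk1 : k 1 = C⁻¹ := rfl
      have hF : F s = ((s - 1)⁻¹ + riemannZeta₀ s) * ((s - 1)⁻¹ + riemannZeta₀ s) * k s := by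
        simp only [hFdef, hk, riemannZeta_eq_inv_sub_add hs1, div_eq_mul_inv]
      rw [hF, slope_def_field, hk1]
      field_simp
      ring
    · rw [if_pos rfl, if_pos rfl]
      have hc : ContinuousAt (fun s : ℂ => riemannZeta s * riemannZeta s)
          ((a + b / 2 : ℝ) : ℂ) :=
        ((differentiableAt_riemannZeta hm1.symm).mul
          (differentiableAt_riemannZeta hm1.symm)).continuousAt
      have := (hc.tendsto.mono_left nhdsWithin_le_nhds).mul (tendsto_sub_mul_inv_cos (a := a) hb)
      have e' : ((a + b / 2 : ℝ) : ℂ) = a + b / 2 := by push_cast; ring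
      rw [e'] at this ⊢
      refine this.congr fun s => ?_
      simp only [hFdef]; ring
  · exact stripDecay_mul_div_cos (M := 1⁻¹ + 2 + a⁻¹) hb
      (fun s h1 _ h3 => norm_riemannZeta_le_of_one_le_abs_im ha h1 h3)
      fun s h1 _ h3 => norm_riemannZeta_le_of_one_le_abs_im ha h1 h3
  · simpa only [hleft] using hX
  · simp only [hright]
    exact hY.comp_neg.neg

/-- The cases `ε = 1` and `ε = -1` are the second and third integrals. -/
lemma integrable_add_sq_and_integral (ha : 0 < a) (ha1 : a < 1) (hab : 1 < a + b) (ε : ℂ)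
    (hε : ε ^ 2 = 1) :
    Integrable (fun v : ℝ => (riemannZeta (a + Complex.I * v)
      + ε * riemannZeta (a + b - Complex.I * v)) ^ 2 / Complex.cosh (Real.pi * v / b)) ∧
    ∫ v : ℝ, (riemannZeta (a + Complex.I * v)
      + ε * riemannZeta (a + b - Complex.I * v)) ^ 2 / Complex.cosh (Real.pi * v / b) =
    (∫ v : ℝ, riemannZeta (a + Complex.I * v) * riemannZeta (a + Complex.I * v)
        / Complex.cosh (Real.pi * v / b)) +
      (∫ v : ℝ, riemannZeta (a + b - Complex.I * v) * riemannZeta (a + b - Complex.I * v)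
        / Complex.cosh (Real.pi * v / b)) +
      2 * ε * ∫ v : ℝ, riemannZeta (a + Complex.I * v) * riemannZeta (a + b - Complex.I * v)
        / Complex.cosh (Real.pi * v / b) := by
  obtain ⟨hI, hX, hY⟩ := integrable_riemannZeta_mul_div_cosh ha ha1 hab
  have e : (fun v : ℝ => (riemannZeta (a + Complex.I * v)
      + ε * riemannZeta (a + b - Complex.I * v)) ^ 2 / Complex.cosh (Real.pi * v / b)) =
      fun v : ℝ => (riemannZeta (a + Complex.I * v) * riemannZeta (a + Complex.I * v)
        / Complex.cosh (Real.pi * v / b) +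
      riemannZeta (a + b - Complex.I * v) * riemannZeta (a + b - Complex.I * v)
        / Complex.cosh (Real.pi * v / b)) +
      2 * ε * (riemannZeta (a + Complex.I * v) * riemannZeta (a + b - Complex.I * v)
        / Complex.cosh (Real.pi * v / b)) := by
    funext v
    linear_combination riemannZeta (a + b - Complex.I * v) ^ 2 /
      Complex.cosh (Real.pi * v / b) * hε
  rw [e]
  refine ⟨(hX.add hY).add (hI.const_mul _), ?_⟩
  refine (integral_add (hX.add hY) (hI.const_mul _)).trans ?_
  rw [integral_const_mul]
  congr 1
  exact integral_add hX hY

end Edges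

/-! ### The degenerate case `a = 1 - b/2` -/

/-- The numerator is `y³/3` up to an error of at most `|y|⁴`, by the Taylor bounds for sine and
cosine. -/
lemma tendsto_sin_sub_mul_cos_div :
    Tendsto (fun y : ℝ => (Real.sin y - y * Real.cos y) / y ^ 3) (𝓝[≠] 0) (𝓝 (1 / 3)) := by
  rw [tendsto_iff_norm_sub_tendsto_zero]
  have h0 : Tendsto (fun y : ℝ => |y|) (𝓝[≠] 0) (𝓝 0) := by
    have : Tendsto (fun y : ℝ => |y|) (𝓝 0) (𝓝 |0|) := continuous_abs.tendsto 0
    rw [abs_zero] at this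
    exact this.mono_left nhdsWithin_le_nhds
  refine squeeze_zero' (Eventually.of_forall fun _ => norm_nonneg _) ?_ h0
  have h1 : ∀ᶠ y : ℝ in 𝓝[≠] 0, |y| ≤ 1 :=
    (h0.eventually (gt_mem_nhds one_pos)).mono fun _ h => h.le
  filter_upwards [h1, self_mem_nhdsWithin] with y hy hy0
  have hy0 : y ≠ 0 := hy0
  have hs := abs_le.1 (Real.sin_bound hy)
  have hc := Real.cos_bound hy
  have hyc : |y * (Real.cos y - (1 - y ^ 2 / 2))| ≤ |y| ^ 4 * (5 / 96) := by
    rw [abs_mul]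
    calc |y| * |Real.cos y - (1 - y ^ 2 / 2)| ≤ 1 * (|y| ^ 4 * (5 / 96)) := by gcongr
      _ = _ := one_mul _
  have hyc := abs_le.1 hyc
  have e : (Real.sin y - y * Real.cos y) / y ^ 3 - 1 / 3 =
      (Real.sin y - y * Real.cos y - y ^ 3 / 3) / y ^ 3 := by field_simp
  have hp : 0 ≤ |y| ^ 4 := by positivity
  rw [e, norm_div, Real.norm_eq_abs, norm_pow, Real.norm_eq_abs,
    div_le_iff₀ (pow_pos (abs_pos.2 hy0) 3), ← pow_succ', abs_le]
  constructor <;> nlinarith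

lemma tendsto_id_div_sin : Tendsto (fun y : ℝ => y / Real.sin y) (𝓝[≠] 0) (𝓝 1) := by
  have h := hasDerivAt_iff_tendsto_slope.1 (Real.hasDerivAt_sin 0)
  rw [Real.cos_zero] at h
  have := h.inv₀ one_ne_zero
  rw [inv_one] at this
  refine this.congr fun y => ?_
  rw [slope_def_field, Real.sin_zero, sub_zero, sub_zero, inv_div]

lemma eventually_sin_ne_zero : ∀ᶠ y : ℝ in 𝓝[≠] 0, Real.sin y ≠ 0 := by
  have := tendsto_id_div_sin.eventually_ne one_ne_zero
  filter_upwards [this] with y hy h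
  exact hy (by rw [h, div_zero])

lemma tendsto_inv_mul_sin_sub_cos_div_sin_sq :
    Tendsto (fun y : ℝ => 1 / (y * Real.sin y) - Real.cos y / Real.sin y ^ 2) (𝓝[≠] 0)
      (𝓝 (1 / 3)) := by
  have := tendsto_sin_sub_mul_cos_div.mul (tendsto_id_div_sin.pow 2)
  rw [one_pow, mul_one] at this
  refine this.congr' ?_
  filter_upwards [self_mem_nhdsWithin, eventually_sin_ne_zero] with y hy hs
  have hy : y ≠ 0 := hy
  field_simp

/-- Put `τ = a - (1 - b/2)` and `y = πτ/b`, so that `cos A = sin y`, `sin A = -cos y`. With `ζ(1 +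
2τ) = 1/(2τ) + ζ₀(1 + 2τ)` and `ζ₀(1) = γ`, the formula becomes `8b · slope(ζ₀) · y/sin y +
(2π²/b)(1/(y sin y) - cos y/sin² y)`. The slope tends to `ζ₀'(1) = -γ(1)` and the last bracket to
`1/3`. -/
lemma tendsto_residue_formula {b : ℝ} (hb : 0 < b) :
    Tendsto (fun a : ℝ =>
      -(4 * Real.eulerMascheroniConstant * Real.pi / Complex.cos (Real.pi * (a - 1) / b))
        + 2 * Real.pi ^ 2 / b
          * (Complex.sin (Real.pi * (a - 1) / b) / Complex.cos (Real.pi * (a - 1) / b) ^ 2)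
        + 4 * Real.pi * riemannZeta (2 * a - 1 + b)
          / Complex.cos (Real.pi * (a - 1) / b))
      (𝓝[≠] (1 - b / 2)) (𝓝 (-8 * b * stieltjesGamma 1 + 2 * Real.pi ^ 2 / (3 * b))) := by
  have hb' : (b : ℂ) ≠ 0 := by exact_mod_cast hb.ne'
  have hpi : (Real.pi : ℂ) ≠ 0 := by exact_mod_cast Real.pi_ne_zero
  have hy : Tendsto (fun a : ℝ => Real.pi * (a - (1 - b / 2)) / b) (𝓝[≠] (1 - b / 2))
      (𝓝[≠] 0) := by
    refine tendsto_nhdsWithin_iff.2 ⟨?_, ?_⟩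
    · have : Tendsto (fun a : ℝ => Real.pi * (a - (1 - b / 2)) / b) (𝓝 (1 - b / 2))
          (𝓝 (Real.pi * (1 - b / 2 - (1 - b / 2)) / b)) :=
        Continuous.tendsto (by fun_prop) _
      rw [sub_self, mul_zero, zero_div] at this
      exact this.mono_left nhdsWithin_le_nhds
    · filter_upwards [self_mem_nhdsWithin] with a ha
      exact div_ne_zero (mul_ne_zero Real.pi_ne_zero (sub_ne_zero.2 ha)) hb.ne'
  have hz : Tendsto (fun a : ℝ => (2 * a - 1 + b : ℂ)) (𝓝[≠] (1 - b / 2)) (𝓝[≠] 1) := by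
    refine tendsto_nhdsWithin_iff.2 ⟨?_, ?_⟩
    · have : Tendsto (fun a : ℝ => (2 * a - 1 + b : ℂ)) (𝓝 (1 - b / 2))
          (𝓝 (2 * ((1 - b / 2 : ℝ) : ℂ) - 1 + b)) :=
        Continuous.tendsto (by fun_prop) _
      have e : 2 * ((1 - b / 2 : ℝ) : ℂ) - 1 + b = 1 := by push_cast; ring
      rw [e] at this
      exact this.mono_left nhdsWithin_le_nhds
    · filter_upwards [self_mem_nhdsWithin] with a ha h
      have h : (2 * a - 1 + b : ℂ) = 1 := h
      have h' : 2 * a - 1 + b = 1 := by exact_mod_cast h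
      exact ha (by show a = _; linarith)
  have t1 := (hasDerivAt_iff_tendsto_slope.1
    (differentiable_riemannZeta₀ 1).hasDerivAt).comp hz
  have t2 := (Complex.continuous_ofReal.tendsto _).comp (tendsto_id_div_sin.comp hy)
  have t3 := (Complex.continuous_ofReal.tendsto _).comp
    (tendsto_inv_mul_sin_sub_cos_div_sin_sq.comp hy)
  have := ((t1.mul t2).const_mul (8 * b : ℂ)).add (t3.const_mul (2 * Real.pi ^ 2 / b : ℂ))
  have e : (8 * b : ℂ) * (deriv riemannZeta₀ 1 * ((1 : ℝ) : ℂ)) +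
      2 * Real.pi ^ 2 / b * ((1 / 3 : ℝ) : ℂ) =
      -8 * b * stieltjesGamma 1 + 2 * Real.pi ^ 2 / (3 * b) := by
    rw [stieltjesGamma, iteratedDeriv_one]
    push_cast
    field_simp
  rw [e] at this
  refine this.congr' ?_
  filter_upwards [self_mem_nhdsWithin, hy.eventually eventually_sin_ne_zero, hz self_mem_nhdsWithin]
    with a ha hs h1
  have h1 : (2 * a - 1 + b : ℂ) ≠ 1 := h1
  set y : ℝ := Real.pi * (a - (1 - b / 2)) / b with hydef
  have hτ : (a : ℂ) - (1 - b / 2) ≠ 0 := fun h => ha (by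
    have : a - (1 - b / 2) = 0 := by exact_mod_cast h
    show a = _; linarith)
  have hyc : (y : ℂ) = Real.pi * (a - (1 - b / 2)) / b := by rw [hydef]; push_cast; ring
  have harg : (Real.pi * (a - 1) / b : ℂ) = y - Real.pi / 2 := by
    rw [hyc]; field_simp; ring
  rw [harg, Complex.cos_sub_pi_div_two, Complex.sin_sub_pi_div_two,
    riemannZeta_eq_inv_sub_add h1]
  have hsc : Complex.sin (y : ℂ) ≠ 0 := by
    rw [← Complex.ofReal_sin]; exact_mod_cast hs
  simp only [Function.comp, slope_def_field, riemannZeta₀_one]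
  rw [← hydef]
  push_cast
  have e1 : (2 * a - 1 + b - 1 : ℂ) = 2 * (a - (1 - b / 2)) := by ring
  rw [e1]
  set τ : ℂ := (a : ℂ) - (1 - b / 2)
  rw [show (Complex.ofReal y) = Real.pi * τ / b from hyc] at hsc ⊢
  field_simp
  ring

/-- Dominated convergence: near `a = 1 - b/2` both lines stay at distance at least `b/4` from the
pole, and `b < 2` keeps them in a half-plane `re s ≥ a₀/2 > 0`, so one growth constant serves all
`a`. -/
lemma integrable_sub_sq_and_integral_symm {b : ℝ} (hb : 0 < b) (hb2 : b < 2) :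
    Integrable (fun v : ℝ =>
      (riemannZeta (1 - b / 2 + Complex.I * v) - riemannZeta (1 + b / 2 - Complex.I * v)) ^ 2
        / Complex.cosh (Real.pi * v / b)) ∧
    Tendsto (fun a : ℝ => ∫ v : ℝ,
      (riemannZeta (a + Complex.I * v) - riemannZeta (a + b - Complex.I * v)) ^ 2
        / Complex.cosh (Real.pi * v / b)) (𝓝[≠] (1 - b / 2))
      (𝓝 (∫ v : ℝ,
        (riemannZeta (1 - b / 2 + Complex.I * v) - riemannZeta (1 + b / 2 - Complex.I * v)) ^ 2
          / Complex.cosh (Real.pi * v / b))) := by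
  set a₀ : ℝ := 1 - b / 2 with ha₀
  have h0 : 0 < a₀ := by rw [ha₀]; linarith
  have hint : ∀ a : ℝ, 0 < a → a < 1 → 1 < a + b → Integrable (fun v : ℝ =>
      (riemannZeta (a + Complex.I * v) - riemannZeta (a + b - Complex.I * v)) ^ 2
        / Complex.cosh (Real.pi * v / b)) := fun a h1 h2 h3 => by
    simpa [← sub_eq_add_neg] using (integrable_add_sq_and_integral h1 h2 h3 (-1) (by norm_num)).1
  have e1 : (1 - b / 2 : ℂ) = a₀ := by rw [ha₀]; push_cast; ring
  have e2 : (1 + b / 2 : ℂ) = a₀ + b := by rw [ha₀]; push_cast; ring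
  rw [e1, e2]
  refine ⟨hint a₀ h0 (by linarith) (by linarith), ?_⟩
  have hnear : ∀ᶠ a : ℝ in 𝓝[≠] a₀, a₀ / 2 ≤ a ∧ a ≤ 1 - b / 4 ∧ 1 + b / 4 ≤ a + b := by
    have n1 : ∀ᶠ a : ℝ in 𝓝 a₀, a₀ / 2 < a := lt_mem_nhds (by linarith)
    have n2 : ∀ᶠ a : ℝ in 𝓝 a₀, a < 1 - b / 4 := gt_mem_nhds (by linarith)
    have n3 : ∀ᶠ a : ℝ in 𝓝 a₀, 1 - 3 * b / 4 < a := lt_mem_nhds (by linarith)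
    refine nhdsWithin_le_nhds ?_
    filter_upwards [n1, n2, n3] with a m1 m2 m3 using ⟨m1.le, m2.le, by linarith⟩
  set M : ℝ := (b / 4)⁻¹ + 2 + (a₀ / 2)⁻¹ with hM
  refine tendsto_integral_filter_of_dominated_convergence
    (fun v => 2 * (2 * M) ^ 2 * (1 + 4 / (Real.pi / b)) ^ 4 * (1 + v ^ 2)⁻¹) ?_ ?_
    (integrable_inv_one_add_sq.const_mul _) ?_
  · filter_upwards [hnear] with a ha
    exact (hint a (by linarith [ha.1]) (by linarith [ha.2.1])
      (by linarith [ha.2.2])).aestronglyMeasurable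
  · filter_upwards [hnear] with a ⟨g1, g2, g3⟩
    refine Eventually.of_forall fun v => ?_
    have b1 := norm_riemannZeta_line_le (a := a₀ / 2) (x := a) (δ := b / 4) (by linarith) g1
      (by linarith) (by rw [abs_sub_comm]; exact le_trans (by linarith) (le_abs_self _))
      Complex.I_re (by simp) v
    have b2 := norm_riemannZeta_line_le (a := a₀ / 2) (x := a + b) (δ := b / 4) (σ := -Complex.I)
      (by linarith) (by linarith) (by linarith) (le_trans (by linarith) (le_abs_self _))
      (by simp) (by simp) v
    have e3 : ((a + b : ℝ) : ℂ) + -Complex.I * v = a + b - Complex.I * v := by push_cast; ring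
    rw [e3] at b2
    have b3 : ‖riemannZeta (a + Complex.I * v) - riemannZeta (a + b - Complex.I * v)‖ ≤
        2 * M * (1 + |v|) :=
      (norm_sub_le _ _).trans ((add_le_add b1 b2).trans (le_of_eq (by rw [hM]; ring)))
    rw [sq]
    exact norm_mul_div_cosh_le hb b3 b3
  · refine Eventually.of_forall fun v => ?_
    have n1 : (a₀ : ℂ) + Complex.I * v ≠ 1 := fun h => by
      have : a₀ = 1 := by simpa using congrArg Complex.re h
      linarith
    have n2 : (a₀ : ℂ) + b - Complex.I * v ≠ 1 := fun h => by
      have : a₀ + b = 1 := by simpa using congrArg Complex.re h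
      linarith
    have c1 : ContinuousAt (fun a : ℝ => riemannZeta (a + Complex.I * v)) a₀ :=
      ContinuousAt.comp (f := fun a : ℝ => (a : ℂ) + Complex.I * v)
        (differentiableAt_riemannZeta n1).continuousAt (by fun_prop)
    have c2 : ContinuousAt (fun a : ℝ => riemannZeta (a + b - Complex.I * v)) a₀ :=
      ContinuousAt.comp (f := fun a : ℝ => (a : ℂ) + b - Complex.I * v)
        (differentiableAt_riemannZeta n2).continuousAt (by fun_prop)
    exact (((c1.sub c2).pow 2).div_const _).tendsto.mono_left nhdsWithin_le_nhds

theorem mainTheorem5 :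
    (∀ a b : ℝ, 0 < a → a < 1 → 1 < a + b → a ≠ 1 - b / 2 →
      (Integrable (fun v : ℝ =>
          riemannZeta (a + Complex.I * v) * riemannZeta (a + b - Complex.I * v)
            / Complex.cosh (Real.pi * v / b)) ∧
        ∫ v : ℝ, riemannZeta (a + Complex.I * v) * riemannZeta (a + b - Complex.I * v)
            / Complex.cosh (Real.pi * v / b)
          = b * riemannZeta (a + b / 2) ^ 2
            - 2 * Real.pi * riemannZeta (2 * a - 1 + b) / Complex.cos (Real.pi * (a - 1) / b)) ∧
      (Integrable (fun v : ℝ =>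
          (riemannZeta (a + Complex.I * v) + riemannZeta (a + b - Complex.I * v)) ^ 2
            / Complex.cosh (Real.pi * v / b)) ∧
        ∫ v : ℝ, (riemannZeta (a + Complex.I * v) + riemannZeta (a + b - Complex.I * v)) ^ 2
            / Complex.cosh (Real.pi * v / b)
          = 4 * b * riemannZeta (a + b / 2) ^ 2
            - 4 * Real.eulerMascheroniConstant * Real.pi / Complex.cos (Real.pi * (a - 1) / b)
            + 2 * Real.pi ^ 2 / b
              * (Complex.sin (Real.pi * (a - 1) / b) / Complex.cos (Real.pi * (a - 1) / b) ^ 2)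
            - 4 * Real.pi * riemannZeta (2 * a - 1 + b)
              / Complex.cos (Real.pi * (a - 1) / b)) ∧
      (Integrable (fun v : ℝ =>
          (riemannZeta (a + Complex.I * v) - riemannZeta (a + b - Complex.I * v)) ^ 2
            / Complex.cosh (Real.pi * v / b)) ∧
        ∫ v : ℝ, (riemannZeta (a + Complex.I * v) - riemannZeta (a + b - Complex.I * v)) ^ 2
            / Complex.cosh (Real.pi * v / b)
          = -(4 * Real.eulerMascheroniConstant * Real.pi / Complex.cos (Real.pi * (a - 1) / b))
            + 2 * Real.pi ^ 2 / b
              * (Complex.sin (Real.pi * (a - 1) / b) / Complex.cos (Real.pi * (a - 1) / b) ^ 2)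
            + 4 * Real.pi * riemannZeta (2 * a - 1 + b)
              / Complex.cos (Real.pi * (a - 1) / b))) ∧
    (∀ b : ℝ, 0 < b → b < 2 →
      Tendsto (fun a : ℝ =>
          -(4 * Real.eulerMascheroniConstant * Real.pi / Complex.cos (Real.pi * (a - 1) / b))
            + 2 * Real.pi ^ 2 / b
              * (Complex.sin (Real.pi * (a - 1) / b) / Complex.cos (Real.pi * (a - 1) / b) ^ 2)
            + 4 * Real.pi * riemannZeta (2 * a - 1 + b)
              / Complex.cos (Real.pi * (a - 1) / b))
        (𝓝[≠] (1 - b / 2))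
        (𝓝 (-8 * b * stieltjesGamma 1 + 2 * Real.pi ^ 2 / (3 * b))) ∧
      Integrable (fun v : ℝ =>
          (riemannZeta (1 - b / 2 + Complex.I * v) - riemannZeta (1 + b / 2 - Complex.I * v)) ^ 2
            / Complex.cosh (Real.pi * v / b)) ∧
        ∫ v : ℝ,
          (riemannZeta (1 - b / 2 + Complex.I * v) - riemannZeta (1 + b / 2 - Complex.I * v)) ^ 2
            / Complex.cosh (Real.pi * v / b)
          = -8 * b * stieltjesGamma 1 + 2 * Real.pi ^ 2 / (3 * b)) := by
  refine ⟨fun a b ha ha1 hab hne => ?_, fun b hb hb2 => ?_⟩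
  · have hI := integral_riemannZeta_mul_div_cosh ha ha1 hab hne
    have hJ := integral_riemannZeta_sq_add_div_cosh ha ha1 hab hne
    obtain ⟨p1, p2⟩ := integrable_add_sq_and_integral ha ha1 hab 1 (by norm_num)
    obtain ⟨m1, m2⟩ := integrable_add_sq_and_integral ha ha1 hab (-1) (by norm_num)
    simp only [one_mul] at p1 p2
    simp only [neg_one_mul, ← sub_eq_add_neg] at m1 m2
    refine ⟨⟨(integrable_riemannZeta_mul_div_cosh ha ha1 hab).1, hI⟩, ⟨p1, ?_⟩, ⟨m1, ?_⟩⟩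
    · rw [p2, hJ, hI]; ring
    · rw [m2, hJ, hI]; ring
  · have hlim := tendsto_residue_formula hb
    obtain ⟨hint, hcont⟩ := integrable_sub_sq_and_integral_symm hb hb2
    -- On a punctured neighbourhood the integral equals the closed formula of (A), so the two limits
    -- coincide.
    refine ⟨hlim, hint, tendsto_nhds_unique hcont (hlim.congr' ?_)⟩
    have n1 : ∀ᶠ a : ℝ in 𝓝 (1 - b / 2), 0 < a := lt_mem_nhds (by linarith)
    have n2 : ∀ᶠ a : ℝ in 𝓝 (1 - b / 2), a < 1 := gt_mem_nhds (by linarith)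
    have n3 : ∀ᶠ a : ℝ in 𝓝 (1 - b / 2), 1 - b < a := lt_mem_nhds (by linarith)
    filter_upwards [nhdsWithin_le_nhds n1, nhdsWithin_le_nhds n2, nhdsWithin_le_nhds n3,
      self_mem_nhdsWithin] with a ha ha1 hab hne
    have hab : 1 < a + b := by linarith
    have hI := integral_riemannZeta_mul_div_cosh ha ha1 hab hne
    have hJ := integral_riemannZeta_sq_add_div_cosh ha ha1 hab hne
    obtain ⟨-, m2⟩ := integrable_add_sq_and_integral ha ha1 hab (-1) (by norm_num)
    simp only [neg_one_mul, ← sub_eq_add_neg] at m2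
    rw [m2, hJ, hI]; ring
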